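/- Let $H$ be a finite simple graph whose vertex set is the disjoint union of $\{x,y\}$ and a nonempty set $Z$, such that $\{x,y\}$ is an edge of $H$ and $H$ induces a tree on $Z$; the edges of $H$ between $\{x,y\}$ and $Z$ are arbitrary (possibly none). In the CONGEST model, the network is a connected simple graph $G$ with $n$ nodes and $m$ edges, whose nodes have pairwise distinct identities of $O(\log n)$ bits (say, identities in $\{0,\dots,n^c\}$ for a constant $c$). Initially each node knows $n$, its own identity and its degree, and has a private source of random bits. Computation proceeds in synchronous rounds; in each round every node sends a message of at most $O(\log n)$ bits to each of its neighbors, receives their messages, and performs an arbitrary local computation. At the end every node outputs accept or reject. A graph is $H$-free if it has no subgraph (induced or not) isomorphic to $H$. For $\epsilon\in(0,1)$, a graph $G$ with $m\ge 1$ edges is $\epsilon$-far from being $H$-free (sparse model) if removing fewer than $\epsilon m$ edges of $G$ never results in an $H$-free graph. Then there is a constant $C$, depending only on $H$, such that for every constant $c$ there is a constant $K$, depending only on $H$ and $c$, such that for every $\epsilon\in(0,1)$ there is a randomized distributed algorithm that performs at most $C/\epsilon$ rounds, with messages of at most $K\log_2 n$ bits per edge, direction and round, and satisfies the following on every network $G$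 with identities in $\{0,\dots,n^c\}$: (1) if $G$ is $H$-free, then with probability $1$ all nodes accept; (2) if $G$ is $\epsilon$-far from being $H$-free, then with probability at least $2/3$ at least one node rejects. -/

import Mathlib

open scoped ENNReal

namespace CongestTesting

/-- The patterns composed of an edge `{x, y}` and a (nonempty) tree `T` on the remaining vertices,
with arbitrary connections between them: removing the two endpoints of some edge leaves a tree.
Nothing is required of the edges between `{x, y}` and `T`; there may be none. -/
def IsEdgePlusTree {W : Type*} (H : SimpleGraph W) : Prop :=
  ∃ x y : W, H.Adj x y ∧ (H.induce ({x, y}ᶜ : Set W)).IsTree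

/-- Sparse model: `G` has at least one edge, and removing less than a fraction `ε` of its edges
cannot result in an `H`-free graph (free of subgraphs, induced or not, isomorphic to `H`). -/
def IsFarFromFree {W V : Type*} (H : SimpleGraph W) (ε : ℝ) (G : SimpleGraph V) : Prop :=
  0 < G.edgeSet.ncard ∧
    ∀ S : Set (Sym2 V), S ⊆ G.edgeSet → (S.ncard : ℝ) < ε * G.edgeSet.ncard →
      ¬ H.Free (G.deleteEdges S)

/-- A network: a connected simple graph whose nodes carry pairwise distinct identities. Each
node `v` addresses its neighbours through arbitrarily numbered ports `0, …, deg v - 1`. -/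
structure Network (V : Type*) where
  graph : SimpleGraph V
  connected : graph.Connected
  id : V → ℕ
  id_injective : Function.Injective id
  deg : V → ℕ
  port : ∀ v, Fin (deg v) ≃ graph.neighborSet v

/-- A synchronous randomized message-passing protocol, the same at all nodes. Nodes have
unlimited computational power, so all local computations are arbitrary functions.
* `Coin`: the finite set from which each node privately draws a uniform random element;
* `bandwidth`: the number of bits that a node sends through each port in each round;
* `rounds`: the number of communication rounds, after which each node gives its output;
* `init i d r`: the initial state of a node with identity `i`, degree `d` and random choice `r`;
* `send d s p`: the message that a node of degree `d` in state `s` sends through its port `p`;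
* `recv d s m`: the new state of such a node when it has received `m p` through each port `p`;
* `accept s`: the output in the final state `s` (`true` is accept, `false` is reject). -/
structure Protocol where
  State : Type
  Coin : Type
  coinFintype : Fintype Coin
  coinNonempty : Nonempty Coin
  bandwidth : ℕ
  rounds : ℕ
  init : (i d : ℕ) → Coin → State
  send : (d : ℕ) → State → Fin d → (Fin bandwidth → Bool)
  recv : (d : ℕ) → State → (Fin d → (Fin bandwidth → Bool)) → State
  accept : State → Bool

attribute [instance] Protocol.coinFintype Protocol.coinNonempty

namespace Network

variable {V : Type*}

/-- The port of the `i`-th neighbour of `v` that leads back to `v`. -/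
def backPort (N : Network V) (v : V) (i : Fin (N.deg v)) : Fin (N.deg (N.port v i)) :=
  (N.port (N.port v i)).symm ⟨v, (N.port v i).2.symm⟩

/-- The state of each node after `t` rounds, given the random choices `ω` of all the nodes. -/
def stateAt (N : Network V) (P : Protocol) (ω : V → P.Coin) : ℕ → V → P.State
  | 0, v => P.init (N.id v) (N.deg v) (ω v)
  | t + 1, v => P.recv (N.deg v) (N.stateAt P ω t v) fun i =>
      P.send (N.deg (N.port v i)) (N.stateAt P ω t (N.port v i)) (N.backPort v i)

/-- The output of node `v`. -/
def output (N : Network V) (P : Protocol) (ω : V → P.Coin) (v : V) : Bool :=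
  P.accept (N.stateAt P ω P.rounds v)

open Classical in
/-- The probability of an event, when the nodes make independent uniform random choices, that is,
when `ω` is uniform on the finite set of all functions `V → P.Coin`. -/
noncomputable def prob [Fintype V] (P : Protocol) (E : Set (V → P.Coin)) : ℝ≥0∞ :=
  (PMF.uniformOfFintype (V → P.Coin)).toOuterMeasure E

end Network

end CongestTesting

/-! A trial guesses the place of the edge `{x, y}` of a copy and looks for the tree around it. Each
node draws a colour, which is a node of the tree, and a rank for each of its outgoing arcs, and
follows the least arc it has heard of. Knowing the ends of that arc, a node can check its own
connections to them from its neighbours' identities. The tree is assembled from the leaves up: a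
node is flagged when its connections are right and each child of its colour is the colour of a
flagged neighbour following the same arc. Colours make the assembled map injective, so a flagged
root yields a genuine copy whatever the coins (`exists_copy_of_flag`); hence the error is one-sided.

If the tree is attached to `{x, y}`, then `H` is connected and the arc has to travel only a bounded
distance. Removing all edges that play the role of `{x, y}` destroys all copies, so an `ε`-far
network has at least `ε m` arcs in that role (`IsFarFromFree.le_ncard_copyArcs`). Each of them is
the only arc of rank below a suitable threshold with probability at least `1 / (16 m)`, and these
events are disjoint. So a trial succeeds with probability at least a constant times `ε`
(`acceptProb_search_le_of_arcs`), and `O(1 / ε)` independent trials suffice.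

If the tree is not attached, the edge may be far away from it. But in a connected network a copy of
the tree and a disjoint edge force a path of length two that leaves the tree at some node
(`exists_pendant_path`). The tree extended by this path is again a tree, which contains `H` and is
found by colours alone with constant probability. -/

namespace CongestTesting

/-! ### Algorithms with arbitrary messages, and their acceptance probabilities -/

/-- A message-passing algorithm whose messages are taken from an arbitrary type. -/
structure LocalAlgorithm (M : Type) where
  State : Type
  Coin : Type
  coinFintype : Fintype Coin
  coinNonempty : Nonempty Coin
  init : (i d : ℕ) → Coin → State
  send : (d : ℕ) → State → Fin d → M
  recv : (d : ℕ) → State → (Fin d → M) → State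
  accept : State → Bool

attribute [instance] LocalAlgorithm.coinFintype LocalAlgorithm.coinNonempty

namespace Network

variable {V : Type*} {M : Type}

/-- The state of each node after `t` rounds of a local algorithm. -/
def run (N : Network V) (A : LocalAlgorithm M) (ω : V → A.Coin) : ℕ → V → A.State
  | 0, v => A.init (N.id v) (N.deg v) (ω v)
  | t + 1, v => A.recv (N.deg v) (N.run A ω t v) fun i =>
      A.send (N.deg (N.port v i)) (N.run A ω t (N.port v i)) (N.backPort v i)

/-- All nodes accept after `R` rounds. -/
def AllAccept (N : Network V) (A : LocalAlgorithm M) (R : ℕ) (ω : V → A.Coin) : Prop :=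
  ∀ v, A.accept (N.run A ω R v) = true

/-- The probability that all nodes accept after `R` rounds. -/
noncomputable def acceptProb (N : Network V) (A : LocalAlgorithm M) (R : ℕ) : ℝ :=
  Nat.card {ω : V → A.Coin // N.AllAccept A R ω} / Nat.card (V → A.Coin)

lemma acceptProb_nonneg (N : Network V) (A : LocalAlgorithm M) (R : ℕ) :
    0 ≤ N.acceptProb A R := by
  unfold acceptProb; positivity

lemma acceptProb_le_one [Finite V] (N : Network V) (A : LocalAlgorithm M) (R : ℕ) :
    N.acceptProb A R ≤ 1 := by
  unfold acceptProb
  refine div_le_one_of_le₀ ?_ (by positivity)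
  exact_mod_cast Nat.card_le_card_of_injective _ Subtype.val_injective

end Network

/-- Messages of a local algorithm encoded as bit strings. -/
def LocalAlgorithm.toProtocol {M : Type} (A : LocalAlgorithm M) (β R : ℕ)
    (enc : M → Fin β → Bool) (dec : (Fin β → Bool) → M) : Protocol where
  State := A.State
  Coin := A.Coin
  coinFintype := A.coinFintype
  coinNonempty := A.coinNonempty
  bandwidth := β
  rounds := R
  init := A.init
  send d s p := enc (A.send d s p)
  recv d s m := A.recv d s fun i => dec (m i)
  accept := A.accept

namespace Network

variable {V : Type*} {M : Type}

lemma stateAt_toProtocol (N : Network V) (A : LocalAlgorithm M) {β R : ℕ}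
    {enc : M → Fin β → Bool} {dec : (Fin β → Bool) → M} (h : ∀ m, dec (enc m) = m)
    (ω : V → A.Coin) (t : ℕ) (v : V) :
    N.stateAt (A.toProtocol β R enc dec) ω t v = N.run A ω t v := by
  induction t generalizing v with
  | zero => rfl
  | succ t ih =>
    simp only [stateAt, run, ih]
    simp only [LocalAlgorithm.toProtocol, h]

lemma forall_output_toProtocol_iff (N : Network V) (A : LocalAlgorithm M) {β R : ℕ}
    {enc : M → Fin β → Bool} {dec : (Fin β → Bool) → M} (h : ∀ m, dec (enc m) = m)
    (ω : V → A.Coin) :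
    (∀ v, N.output (A.toProtocol β R enc dec) ω v = true) ↔ N.AllAccept A R ω := by
  refine forall_congr' fun v => ?_
  unfold output
  rw [stateAt_toProtocol N A h]
  rfl

lemma prob_eq [Fintype V] (P : Protocol) (E : Set (V → P.Coin)) :
    prob P E = (Nat.card E : ℝ≥0∞) / Nat.card (V → P.Coin) := by
  classical
  rw [prob, PMF.toOuterMeasure_uniformOfFintype_apply, Nat.card_eq_fintype_card,
    Nat.card_eq_fintype_card]

lemma prob_eq_one [Fintype V] (P : Protocol) {E : Set (V → P.Coin)} (h : ∀ ω, ω ∈ E) :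
    prob P E = 1 := by
  have : E = Set.univ := Set.eq_univ_of_forall h
  subst this
  rw [prob_eq, Nat.card_congr (Equiv.Set.univ _)]
  exact ENNReal.div_self (by exact_mod_cast Nat.card_pos.ne') (ENNReal.natCast_ne_top _)

lemma two_thirds_le_prob [Fintype V] (N : Network V) (A : LocalAlgorithm M) {β R : ℕ}
    {enc : M → Fin β → Bool} {dec : (Fin β → Bool) → M} (h : ∀ m, dec (enc m) = m)
    (hA : N.acceptProb A R ≤ 1 / 3) :
    2 / 3 ≤ prob (A.toProtocol β R enc dec)
      {ω | ∃ v, N.output (A.toProtocol β R enc dec) ω v = false} := by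
  classical
  have key (ω : V → A.Coin) : (∃ v, N.output (A.toProtocol β R enc dec) ω v = false) ↔
      ¬ N.AllAccept A R ω := by
    rw [← forall_output_toProtocol_iff N A h ω]
    simp only [not_forall, Bool.not_eq_true]
  have hE : {ω : V → A.Coin | ∃ v, N.output (A.toProtocol β R enc dec) ω v = false}
      = {ω : V → A.Coin | N.AllAccept A R ω}ᶜ := Set.ext key
  refine le_of_le_of_eq ?_ ((congrArg (prob (A.toProtocol β R enc dec)) hE).trans
    (prob_eq (A.toProtocol β R enc dec) _)).symm
  have hcard := Set.ncard_add_ncard_compl {ω : V → A.Coin | N.AllAccept A R ω}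
  rw [← Nat.card_coe_set_eq, ← Nat.card_coe_set_eq] at hcard
  have hT : 0 < Nat.card (V → A.Coin) := Nat.card_pos
  change (Nat.card ↑{ω : V → A.Coin | N.AllAccept A R ω} : ℝ) / Nat.card (V → A.Coin) ≤ 1 / 3 at hA
  change 2 / 3 ≤ (Nat.card ↑({ω : V → A.Coin | N.AllAccept A R ω}ᶜ) : ℝ≥0∞) / Nat.card (V → A.Coin)
  generalize Nat.card ↑{ω : V → A.Coin | N.AllAccept A R ω} = a at *
  generalize Nat.card ↑({ω : V → A.Coin | N.AllAccept A R ω}ᶜ) = b at *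
  generalize Nat.card (V → A.Coin) = T at *
  have hT' : (0 : ℝ) < T := by exact_mod_cast hT
  rw [div_le_iff₀ hT'] at hA
  have h1 : (a : ℝ) + b = T := by exact_mod_cast hcard
  have h2 : 2 * T ≤ b * 3 := by
    have : (2 : ℝ) * T ≤ b * 3 := by linarith
    exact_mod_cast this
  rw [ENNReal.le_div_iff_mul_le (by simp [hT.ne']) (by simp), ← ENNReal.mul_div_right_comm]
  exact ENNReal.div_le_of_le_mul (by exact_mod_cast h2)

end Network

/-! ### Sequential composition with independent coins -/

/-- Execute the algorithms `P 0, …, P (k - 1)` one after the other, for `R` rounds each, with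
independent coins, and accept if all of them do. -/
def sequential {M : Type} [Inhabited M] {k : ℕ} (P : Fin k → LocalAlgorithm M) (R : ℕ) :
    LocalAlgorithm M where
  State := ℕ × ∀ j, (P j).State
  Coin := ∀ j, (P j).Coin
  coinFintype := inferInstance
  coinNonempty := inferInstance
  init i d r := (0, fun j => (P j).init i d (r j))
  send d s p := if h : s.1 / R < k then (P ⟨s.1 / R, h⟩).send d (s.2 ⟨s.1 / R, h⟩) p else default
  recv d s m := (s.1 + 1, fun j => if (j : ℕ) = s.1 / R then (P j).recv d (s.2 j) m else s.2 j)
  accept s := decide (∀ j, (P j).accept (s.2 j) = true)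

namespace Network

variable {V : Type*} {M : Type} [Inhabited M] {k : ℕ}

lemma send_sequential (P : Fin k → LocalAlgorithm M) (R : ℕ) (j : Fin k) (d : ℕ)
    (s : (sequential P R).State) (p : Fin d) (h : (j : ℕ) = s.1 / R) :
    (sequential P R).send d s p = (P j).send d (s.2 j) p := by
  have hk : s.1 / R < k := h ▸ j.2
  obtain rfl : j = ⟨s.1 / R, hk⟩ := Fin.ext h
  exact dif_pos hk

lemma run_sequential_fst (N : Network V) (P : Fin k → LocalAlgorithm M) (R : ℕ)
    (ω : V → (sequential P R).Coin) (t : ℕ) (v : V) :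
    (N.run (sequential P R) ω t v).1 = t := by
  induction t with
  | zero => rfl
  | succ t ih => exact congrArg (· + 1) ih

/-- All round counters agree, so neighbours are always in the same phase. The truncated expression
counts the rounds spent so far on algorithm `j`: none before its phase, `R` after it. -/
lemma run_sequential_snd (N : Network V) (P : Fin k → LocalAlgorithm M) {R : ℕ} (hR : 0 < R)
    (ω : V → ∀ j, (P j).Coin) (t : ℕ) (v : V) (j : Fin k) :
    (N.run (sequential P R) ω t v).2 j
      = N.run (P j) (fun u => ω u j) (min R (t - j * R)) v := by
  induction t generalizing v with
  | zero => simp [run, sequential]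
  | succ t ih =>
    have hfst : (N.run (sequential P R) ω t v).1 / R = t / R :=
      congrArg (· / R) (run_sequential_fst N P R ω t v)
    change (if (j : ℕ) = (N.run (sequential P R) ω t v).1 / R then
        (P j).recv (N.deg v) ((N.run (sequential P R) ω t v).2 j) (fun i =>
          (sequential P R).send (N.deg (N.port v i)) (N.run (sequential P R) ω t (N.port v i))
            (N.backPort v i)) else (N.run (sequential P R) ω t v).2 j) = _
    split_ifs with hj
    · replace hj := hj.trans hfst
      have h1 : (j : ℕ) * R ≤ t := hj ▸ Nat.div_mul_le_self t R
      have h2 : t < j * R + R := by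
        have := Nat.lt_div_mul_add (a := t) hR
        rwa [← hj] at this
      have h3 : min R (t + 1 - j * R) = min R (t - j * R) + 1 := by omega
      rw [h3, run, ih]
      congr 1
      funext i
      rw [send_sequential P R j _ _ _ (hj.trans
        (congrArg (· / R) (run_sequential_fst N P R ω t _)).symm), ih]
    · replace hj : (j : ℕ) ≠ t / R := fun h => hj (h.trans hfst.symm)
      have h3 : min R (t + 1 - j * R) = min R (t - j * R) := by
        by_contra hne
        have h1 : (j : ℕ) * R ≤ t := by omega
        have h2 : t < j * R + R := by omega
        exact hj (Nat.div_eq_of_lt_le h1 (by rwa [add_one_mul])).symm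
      rw [h3, ih]

lemma allAccept_sequential_iff (N : Network V) (P : Fin k → LocalAlgorithm M) {R : ℕ} (hR : 0 < R)
    (ω : V → ∀ j, (P j).Coin) :
    N.AllAccept (sequential P R) (k * R) ω ↔ ∀ j, N.AllAccept (P j) R (fun u => ω u j) := by
  have h : ∀ j : Fin k, min R (k * R - j * R) = R := fun j => by
    rw [← Nat.sub_mul]
    exact min_eq_left (Nat.le_mul_of_pos_left _ (by omega))
  have h' (v : V) : (sequential P R).accept (N.run (sequential P R) ω (k * R) v) = true ↔
      ∀ j, (P j).accept (N.run (P j) (fun u => ω u j) R v) = true := by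
    refine decide_eq_true_iff.trans (forall_congr' fun j => ?_)
    rw [run_sequential_snd N P hR, h]
  exact (forall_congr' h').trans forall_comm

/-- The accepting coins form a product set, one factor for each algorithm. -/
lemma acceptProb_sequential [Finite V] (N : Network V) (P : Fin k → LocalAlgorithm M) {R : ℕ}
    (hR : 0 < R) : N.acceptProb (sequential P R) (k * R) = ∏ j, N.acceptProb (P j) R := by
  unfold acceptProb
  rw [Finset.prod_div_distrib, ← Nat.cast_prod, ← Nat.cast_prod, ← Nat.card_pi, ← Nat.card_pi]
  congr 2
  · refine Nat.card_congr (((Equiv.piComm _).subtypeEquiv fun ω => ?_).trans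
      (Equiv.subtypePiEquivPi (p := fun j => N.AllAccept (P j) R)))
    exact allAccept_sequential_iff N P hR ω
  · exact Nat.card_congr (Equiv.piComm _)

end Network

/-! ### The search for a tree around a random arc -/

/-- A rooted tree with node set `Q`, given by parents and depths, to be searched for in a network,
some of whose nodes have to be adjacent to the tail or to the head of an arc of the network.
If `useArc` fails, only the tree is searched for. -/
structure TreePattern (Q : Type) where
  root : Q
  par : Q → Q
  depth : Q → ℕ
  depth_root : depth root = 0
  depth_of_ne_root : ∀ q, q ≠ root → depth q = depth (par q) + 1
  useArc : Prop
  adjTail : Q → Prop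
  adjHead : Q → Prop

/-- Arcs of the network, represented by a rank and the identities of their ends; `⊤` is no arc. -/
abbrev ArcKey (R I : ℕ) : Type := WithTop (Fin R ×ₗ Fin I ×ₗ Fin I)

/-- The key of an arc of given rank and ends. -/
def ArcKey.mk {R I : ℕ} (r : Fin R) (i j : Fin I) : ArcKey R I :=
  ((toLex (r, toLex (i, j)) : Fin R ×ₗ Fin I ×ₗ Fin I) : ArcKey R I)

lemma ArcKey.mk_inj {R I : ℕ} {r r' : Fin R} {i j i' j' : Fin I} :
    ArcKey.mk r i j = ArcKey.mk r' i' j' ↔ r = r' ∧ i = i' ∧ j = j' := by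
  simp [ArcKey.mk]

lemma ArcKey.mk_le_mk_of_lt {R I : ℕ} {r r' : Fin R} (h : r < r') (i j i' j' : Fin I) :
    ArcKey.mk r i j ≤ ArcKey.mk r' i' j' := by
  refine WithTop.coe_le_coe.2 (le_of_lt ?_)
  exact Prod.Lex.toLex_lt_toLex.2 (Or.inl h)

/-- The messages exchanged in the search for a tree pattern. -/
structure SearchMessage (R I : ℕ) (Q : Type) where
  id : Fin I
  rank : Fin R
  color : Q
  best : ArcKey R I
  flag : Bool

/-- The states of the nodes in the search for a tree pattern. -/
structure SearchState (n R I : ℕ) (Q : Type) where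
  id : Fin I
  color : Q
  rank : Fin n → Fin R
  best : ArcKey R I
  flag : Bool

/-- The rank of a port, given the ranks of the first `n` ports. -/
def portRank {n R : ℕ} [NeZero R] (r : Fin n → Fin R) (p : ℕ) : Fin R :=
  -- The default is never taken when all degrees are at most `n`.
  if h : p < n then r ⟨p, h⟩ else 0

/-- The least arc that a node knows after receiving the messages `m`. -/
def SearchState.nextBest {n R I d : ℕ} {Q : Type} (s : SearchState n R I Q)
    (m : Fin d → SearchMessage R I Q) : ArcKey R I :=
  -- A node learns at first hand the arcs that enter it: the neighbour at the tail supplies the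
  -- rank.
  s.best ⊓ Finset.univ.inf fun p => (m p).best ⊓ ArcKey.mk (m p).rank (m p).id s.id

/-- The condition for a node to be flagged as the root of a copy of the part of the pattern below
its colour. -/
def TreePattern.Good {n R I d : ℕ} {Q : Type} (P : TreePattern Q) (s : SearchState n R I Q)
    (m : Fin d → SearchMessage R I Q) : Prop :=
  (P.useArc → ∃ r i j, s.nextBest m = ArcKey.mk r i j ∧ s.id ≠ i ∧ s.id ≠ j ∧
    (P.adjTail s.color → ∃ p, (m p).id = i) ∧ (P.adjHead s.color → ∃ p, (m p).id = j)) ∧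
  -- The child's arc before the round is compared with the node's own arc after it; chained along
  -- the levels, this makes the whole tree agree on one arc.
  ∀ q, q ≠ P.root → P.par q = s.color → ∃ p, (m p).color = q ∧ (m p).flag = true ∧
    (P.useArc → (m p).best = s.nextBest m)

open Classical in
/-- The search for a tree pattern by random colours and random ranks of the arcs. Every node
follows the least arc it has heard of, and is flagged when it is the root of a correctly coloured
copy of the part of the pattern below its colour. -/
noncomputable def TreePattern.search {Q : Type} [Fintype Q] (P : TreePattern Q) (n R I : ℕ)
    [NeZero R] [NeZero I] : LocalAlgorithm (SearchMessage R I Q) where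
  State := SearchState n R I Q
  Coin := Q × (Fin n → Fin R)
  coinFintype := inferInstance
  coinNonempty := ⟨(P.root, 0)⟩
  init i _ r := ⟨Fin.ofNat I i, r.1, r.2, ⊤, false⟩
  send _ s p := ⟨s.id, portRank s.rank p, s.color, s.best, s.flag⟩
  recv _ s m := { s with best := s.nextBest m, flag := decide (P.Good s m) }
  accept s := decide (s.flag = true → s.color ≠ P.root)

namespace Network

variable {V : Type*} {Q : Type} [Fintype Q] (N : Network V) (P : TreePattern Q) {n R I : ℕ}
  [NeZero R] [NeZero I] (ω : V → Q × (Fin n → Fin R))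

/-- The port of `u` that leads to its neighbour `v`. -/
def portTo (N : Network V) {u v : V} (h : N.graph.Adj u v) : Fin (N.deg u) :=
  (N.port u).symm ⟨v, h⟩

lemma port_portTo {u v : V} (h : N.graph.Adj u v) : (N.port u (N.portTo h) : V) = v := by
  simp [portTo]

lemma portTo_inj {u v w : V} (h : N.graph.Adj u v) (h' : N.graph.Adj u w)
    (he : N.portTo h = N.portTo h') : v = w := by
  rw [← N.port_portTo h, he, N.port_portTo h']

lemma adj_port (u : V) (p : Fin (N.deg u)) : N.graph.Adj u (N.port u p) := (N.port u p).2

/-- The key of the arc from `u` to `v`. -/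
def arcKey (I : ℕ) [NeZero I] {u v : V} (h : N.graph.Adj u v) : ArcKey R I :=
  ArcKey.mk (portRank (ω u).2 (N.portTo h)) (Fin.ofNat I (N.id u)) (Fin.ofNat I (N.id v))

/-- The state of each node after `t` rounds of the search for a tree pattern. -/
noncomputable def searchAt (I : ℕ) [NeZero I] (t : ℕ) (v : V) : SearchState n R I Q :=
  N.run (P.search n R I) ω t v

/-- The messages that node `v` receives in round `t + 1`. -/
noncomputable def searchMsg (I : ℕ) [NeZero I] (t : ℕ) (v : V) (p : Fin (N.deg v)) :
    SearchMessage R I Q :=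
  ⟨(N.searchAt P ω I t (N.port v p)).id,
    portRank (N.searchAt P ω I t (N.port v p)).rank (N.portTo (N.adj_port v p).symm),
    (N.searchAt P ω I t (N.port v p)).color, (N.searchAt P ω I t (N.port v p)).best,
    (N.searchAt P ω I t (N.port v p)).flag⟩

open Classical in
lemma searchAt_succ (t : ℕ) (v : V) :
    N.searchAt P ω I (t + 1) v = { N.searchAt P ω I t v with
      best := (N.searchAt P ω I t v).nextBest (N.searchMsg P ω I t v)
      flag := decide (P.Good (N.searchAt P ω I t v) (N.searchMsg P ω I t v)) } := rfl

lemma searchAt_id (t : ℕ) (v : V) : (N.searchAt P ω I t v).id = Fin.ofNat I (N.id v) := by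
  induction t with
  | zero => rfl
  | succ t ih => rw [searchAt_succ]; exact ih

lemma searchAt_color (t : ℕ) (v : V) : (N.searchAt P ω I t v).color = (ω v).1 := by
  induction t with
  | zero => rfl
  | succ t ih => rw [searchAt_succ]; exact ih

lemma searchAt_rank (t : ℕ) (v : V) : (N.searchAt P ω I t v).rank = (ω v).2 := by
  induction t with
  | zero => rfl
  | succ t ih => rw [searchAt_succ]; exact ih

lemma best_succ (t : ℕ) (v : V) :
    (N.searchAt P ω I (t + 1) v).best = (N.searchAt P ω I t v).best ⊓
      Finset.univ.inf fun p => (N.searchAt P ω I t (N.port v p)).best ⊓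
        N.arcKey ω I (N.adj_port v p).symm := by
  rw [searchAt_succ]
  simp only [SearchState.nextBest, searchMsg, searchAt_id, searchAt_rank]
  rfl

lemma best_succ_le (t : ℕ) (v : V) :
    (N.searchAt P ω I (t + 1) v).best ≤ (N.searchAt P ω I t v).best := by
  rw [best_succ]; exact inf_le_left

lemma best_antitone (v : V) : Antitone fun t => (N.searchAt P ω I t v).best :=
  antitone_nat_of_succ_le fun t => N.best_succ_le P ω t v

lemma best_succ_le_of_adj (t : ℕ) {u v : V} (h : N.graph.Adj u v) :
    (N.searchAt P ω I (t + 1) v).best ≤ (N.searchAt P ω I t u).best ⊓ N.arcKey ω I h := by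
  rw [best_succ]
  refine inf_le_right.trans ?_
  refine (Finset.inf_le (Finset.mem_univ (N.portTo h.symm))).trans (le_of_eq ?_)
  congr! 3 <;> exact N.port_portTo h.symm

lemma best_le_of_walk (t : ℕ) {u v : V} (p : N.graph.Walk u v) :
    (N.searchAt P ω I (t + p.length) v).best ≤ (N.searchAt P ω I t u).best := by
  induction p generalizing t with
  | nil => exact le_rfl
  | cons h p ih =>
    rw [SimpleGraph.Walk.length_cons, add_comm p.length, ← add_assoc]
    exact (ih (t + 1)).trans ((N.best_succ_le_of_adj P ω t h).trans inf_le_left)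

/-- Keys are linearly ordered, so a minimum of keys is one of them and no arc is ever invented.
Soundness needs this, and so does the lower bound in `best_eq_of_walk`. -/
lemma best_eq_top_or (t : ℕ) (v : V) : (N.searchAt P ω I t v).best = ⊤ ∨
    ∃ u w, ∃ h : N.graph.Adj u w, (N.searchAt P ω I t v).best = N.arcKey ω I h := by
  induction t generalizing v with
  | zero => exact Or.inl rfl
  | succ t ih =>
    rw [best_succ]
    have key : ∀ a b : ArcKey R I,
        (a = ⊤ ∨ ∃ u w, ∃ h : N.graph.Adj u w, a = N.arcKey ω I h) →
        (b = ⊤ ∨ ∃ u w, ∃ h : N.graph.Adj u w, b = N.arcKey ω I h) →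
        (a ⊓ b = ⊤ ∨ ∃ u w, ∃ h : N.graph.Adj u w, a ⊓ b = N.arcKey ω I h) := by
      intro a b ha hb
      rcases le_total a b with h | h
      · rwa [inf_eq_left.2 h]
      · rwa [inf_eq_right.2 h]
    refine key _ _ (ih v) ?_
    refine Finset.inf_induction (p := fun a : ArcKey R I =>
      a = ⊤ ∨ ∃ u w, ∃ h : N.graph.Adj u w, a = N.arcKey ω I h) (Or.inl rfl)
      (fun a ha b hb => key a b ha hb) fun p _ => ?_
    exact key _ _ (ih _) (Or.inr ⟨_, _, _, rfl⟩)

/-- The head `w` hears of the arc in the first round, and the key then advances along the walk;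
nothing smaller exists to replace it. The time needed depends on the distance to `w` only, not on
the size of the network. -/
lemma best_eq_of_walk {u w v : V} (h : N.graph.Adj u w)
    (hmin : ∀ u' w' (h' : N.graph.Adj u' w'), (u', w') ≠ (u, w) →
      portRank (ω u).2 (N.portTo h) < portRank (ω u').2 (N.portTo h'))
    (p : N.graph.Walk w v) {t : ℕ} (ht : p.length + 1 ≤ t) :
    (N.searchAt P ω I t v).best = N.arcKey ω I h := by
  refine le_antisymm ?_ ?_
  · have h1 := N.best_le_of_walk P ω (I := I) 1 p
    have h2 := (N.best_succ_le_of_adj P ω (I := I) 0 h).trans inf_le_right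
    exact (N.best_antitone P ω v (by omega : 1 + p.length ≤ t)).trans (h1.trans h2)
  · rcases N.best_eq_top_or P ω (I := I) t v with h0 | ⟨u', w', h', h0⟩
    · rw [h0]; exact le_top
    · rw [h0]
      by_cases he : (u', w') = (u, w)
      · obtain ⟨rfl, rfl⟩ := Prod.mk.inj he
        exact le_rfl
      · exact ArcKey.mk_le_mk_of_lt (hmin u' w' h' he) _ _ _ _

lemma flag_zero (v : V) : (N.searchAt P ω I 0 v).flag = false := rfl

/-- The flag is recomputed in each round, so a flag earned for an arc since abandoned does not
persist. -/
lemma flag_succ_iff (t : ℕ) (v : V) : (N.searchAt P ω I (t + 1) v).flag = true ↔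
    (P.useArc → ∃ r i j, (N.searchAt P ω I (t + 1) v).best = ArcKey.mk r i j ∧
      Fin.ofNat I (N.id v) ≠ i ∧ Fin.ofNat I (N.id v) ≠ j ∧
      (P.adjTail (ω v).1 → ∃ u, N.graph.Adj v u ∧ Fin.ofNat I (N.id u) = i) ∧
      (P.adjHead (ω v).1 → ∃ u, N.graph.Adj v u ∧ Fin.ofNat I (N.id u) = j)) ∧
    ∀ q, q ≠ P.root → P.par q = (ω v).1 → ∃ u, N.graph.Adj v u ∧ (ω u).1 = q ∧
      (N.searchAt P ω I t u).flag = true ∧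
      (P.useArc → (N.searchAt P ω I t u).best = (N.searchAt P ω I (t + 1) v).best) := by
  have hex : ∀ p : V → Prop, (∃ i, p (N.port v i)) ↔ ∃ u, N.graph.Adj v u ∧ p u := fun p =>
    ⟨fun ⟨i, hi⟩ => ⟨_, N.adj_port v i, hi⟩,
      fun ⟨u, hu, hp⟩ => ⟨N.portTo hu, by rwa [N.port_portTo hu]⟩⟩
  rw [searchAt_succ]
  classical
  refine decide_eq_true_iff.trans ?_
  simp only [TreePattern.Good, searchMsg, searchAt_id, searchAt_color]
  simp only [← hex]

/-! ### Soundness and completeness of the search -/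

/-- A flagged node with the colour of the root is the root of a copy of the pattern. -/
lemma exists_copy_of_flag (hid : ∀ u v, Fin.ofNat I (N.id u) = Fin.ofNat I (N.id v) → u = v)
    {T : ℕ} {v : V} (hv : (ω v).1 = P.root) (hflag : (N.searchAt P ω I T v).flag = true) :
    ∃ f : Q → V, Function.Injective f ∧ (∀ q, q ≠ P.root → N.graph.Adj (f (P.par q)) (f q)) ∧
      (P.useArc → ∃ u w, N.graph.Adj u w ∧ ∀ q, f q ≠ u ∧ f q ≠ w ∧
        (P.adjTail q → N.graph.Adj (f q) u) ∧ (P.adjHead q → N.graph.Adj (f q) w)) := by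
  -- The copy is unfolded from the root downwards. A node at depth `d` is placed where its flag at
  -- time `T - d` justified that of its parent one round later; times stay positive because no flag
  -- is set at time `0`.
  have main : ∀ D : ℕ, ∃ f : Q → V, ∀ q, P.depth q ≤ D →
      P.depth q < T ∧ (ω (f q)).1 = q ∧ (N.searchAt P ω I (T - P.depth q) (f q)).flag = true ∧
      (P.useArc → (N.searchAt P ω I (T - P.depth q) (f q)).best = (N.searchAt P ω I T v).best) ∧
      (q ≠ P.root → N.graph.Adj (f (P.par q)) (f q)) := by
    have hT : ∀ t u, (N.searchAt P ω I t u).flag = true → 0 < t := by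
      intro t u h
      rcases Nat.eq_zero_or_pos t with rfl | h0
      · rw [flag_zero] at h; simp at h
      · exact h0
    intro D
    induction D with
    | zero =>
      refine ⟨fun _ => v, fun q hq => ?_⟩
      have hq : q = P.root := by
        by_contra h
        have := P.depth_of_ne_root q h
        omega
      subst hq
      rw [P.depth_root]
      exact ⟨hT _ _ hflag, hv, hflag, fun _ => rfl, fun h => absurd rfl h⟩
    | succ D ih =>
      obtain ⟨f, hf⟩ := ih
      have hch : ∀ q, P.depth q = D + 1 → ∃ u, P.depth q < T ∧ (ω u).1 = q ∧
          (N.searchAt P ω I (T - P.depth q) u).flag = true ∧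
          (P.useArc → (N.searchAt P ω I (T - P.depth q) u).best = (N.searchAt P ω I T v).best) ∧
          N.graph.Adj (f (P.par q)) u := by
        intro q hq
        have hr : q ≠ P.root := by
          rintro rfl
          rw [P.depth_root] at hq
          omega
        have hd := P.depth_of_ne_root q hr
        obtain ⟨h1, h2, h3, h4, -⟩ := hf (P.par q) (by omega)
        obtain ⟨t, ht⟩ : ∃ t, T - P.depth (P.par q) = t + 1 := ⟨T - P.depth (P.par q) - 1, by omega⟩
        rw [ht] at h3 h4
        obtain ⟨u, hu, hc, hfl, hb⟩ := ((N.flag_succ_iff P ω t _).1 h3).2 q hr h2.symm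
        have ht' : T - P.depth q = t := by omega
        have := hT _ _ hfl
        exact ⟨u, by omega, hc, ht' ▸ hfl, fun h => ht' ▸ (hb h).trans (h4 h), hu⟩
      have : Nonempty V := ⟨v⟩
      choose! g hg using hch
      refine ⟨fun q => if P.depth q = D + 1 then g q else f q, fun q hq => ?_⟩
      by_cases hqd : P.depth q = D + 1
      · have hr : q ≠ P.root := by
          rintro rfl
          rw [P.depth_root] at hqd
          omega
        have hd := P.depth_of_ne_root q hr
        have hp : P.depth (P.par q) ≠ D + 1 := by omega
        simp only [hqd, hp, if_true, if_false]
        have := hg q hqd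
        rw [hqd] at this
        exact ⟨this.1, this.2.1, this.2.2.1, this.2.2.2.1, fun _ => this.2.2.2.2⟩
      · obtain ⟨h1, h2, h3, h4, h5⟩ := hf q (by omega)
        simp only [hqd, if_false]
        refine ⟨h1, h2, h3, h4, fun hr => ?_⟩
        have hd := P.depth_of_ne_root q hr
        have hp : P.depth (P.par q) ≠ D + 1 := by omega
        simp only [hp, if_false]
        exact h5 hr
  obtain ⟨f, hf⟩ := main (Finset.univ.sup P.depth)
  replace hf := fun q => hf q (Finset.le_sup (Finset.mem_univ q))
  refine ⟨f, fun q q' h => ?_, fun q => (hf q).2.2.2.2, fun ha => ?_⟩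
  -- The colour of an image determines its preimage.
  · rw [← (hf q).2.1, ← (hf q').2.1, h]
  have hgood : ∀ q, ∃ r i j, (N.searchAt P ω I T v).best = ArcKey.mk r i j ∧
      Fin.ofNat I (N.id (f q)) ≠ i ∧ Fin.ofNat I (N.id (f q)) ≠ j ∧
      (P.adjTail q → ∃ u, N.graph.Adj (f q) u ∧ Fin.ofNat I (N.id u) = i) ∧
      (P.adjHead q → ∃ u, N.graph.Adj (f q) u ∧ Fin.ofNat I (N.id u) = j) := by
    intro q
    obtain ⟨h1, h2, h3, h4, -⟩ := hf q
    obtain ⟨t, ht⟩ : ∃ t, T - P.depth q = t + 1 := ⟨T - P.depth q - 1, by omega⟩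
    rw [ht] at h3 h4
    have := ((N.flag_succ_iff P ω t _).1 h3).1 ha
    rwa [h4 ha, h2] at this
  rcases N.best_eq_top_or P ω (I := I) T v with h0 | ⟨u, w, h, h0⟩
  · obtain ⟨r, i, j, hb, -⟩ := hgood P.root
    rw [h0] at hb
    exact absurd hb.symm WithTop.coe_ne_top
  · refine ⟨u, w, h, fun q => ?_⟩
    obtain ⟨r, i, j, hb, hi, hj, hX, hY⟩ := hgood q
    rw [h0, arcKey, ArcKey.mk_inj] at hb
    obtain ⟨-, rfl, rfl⟩ := hb
    refine ⟨fun e => hi (by rw [e]), fun e => hj (by rw [e]), fun hx => ?_, fun hy => ?_⟩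
    · obtain ⟨u', hu', he⟩ := hX hx
      rwa [← hid _ _ he]
    · obtain ⟨u', hu', he⟩ := hY hy
      rwa [← hid _ _ he]

/-- The root of a correctly coloured copy of the pattern gets flagged. -/
lemma flag_of_copy (hid : ∀ u v, Fin.ofNat I (N.id u) = Fin.ofNat I (N.id v) → u = v)
    (f : Q → V) (hcol : ∀ q, (ω (f q)).1 = q)
    (hadj : ∀ q, q ≠ P.root → N.graph.Adj (f (P.par q)) (f q)) {T₀ : ℕ}
    (harc : P.useArc → ∃ u w, ∃ h : N.graph.Adj u w,
      (∀ q, f q ≠ u ∧ f q ≠ w ∧ (P.adjTail q → N.graph.Adj (f q) u) ∧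
        (P.adjHead q → N.graph.Adj (f q) w)) ∧
      ∀ q t, T₀ ≤ t → (N.searchAt P ω I t (f q)).best = N.arcKey ω I h)
    {t : ℕ} (ht : T₀ + Finset.univ.sup P.depth < t) :
    (N.searchAt P ω I t (f P.root)).flag = true := by
  -- Flags rise from the deepest level, one level per round: nodes at most `j` levels above it are
  -- flagged at every time after `T₀ + j`.
  have main : ∀ j q, Finset.univ.sup P.depth ≤ P.depth q + j → ∀ t, T₀ + j < t →
      (N.searchAt P ω I t (f q)).flag = true := by
    intro j
    induction j with
    | zero =>
      intro q hq t ht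
      obtain ⟨t, rfl⟩ : ∃ s, t = s + 1 := ⟨t - 1, by omega⟩
      refine (N.flag_succ_iff P ω t _).2 ⟨fun ha => ?_, fun q' hr hq' => ?_⟩
      · obtain ⟨u, w, h, h1, h2⟩ := harc ha
        obtain ⟨hu, hw, hX, hY⟩ := h1 q
        refine ⟨_, _, _, h2 q (t + 1) (by omega), fun e => hu (hid _ _ e),
          fun e => hw (hid _ _ e), fun hx => ⟨u, hX (by rwa [hcol] at hx), rfl⟩,
          fun hy => ⟨w, hY (by rwa [hcol] at hy), rfl⟩⟩
      · rw [hcol] at hq'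
        have h1 := P.depth_of_ne_root q' hr
        have h2 : P.depth q' ≤ Finset.univ.sup P.depth := Finset.le_sup (Finset.mem_univ q')
        rw [hq'] at h1
        omega
    | succ j ih =>
      intro q hq t ht
      obtain ⟨t, rfl⟩ : ∃ s, t = s + 1 := ⟨t - 1, by omega⟩
      refine (N.flag_succ_iff P ω t _).2 ⟨fun ha => ?_, fun q' hr hq' => ?_⟩
      · obtain ⟨u, w, h, h1, h2⟩ := harc ha
        obtain ⟨hu, hw, hX, hY⟩ := h1 q
        refine ⟨_, _, _, h2 q (t + 1) (by omega), fun e => hu (hid _ _ e),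
          fun e => hw (hid _ _ e), fun hx => ⟨u, hX (by rwa [hcol] at hx), rfl⟩,
          fun hy => ⟨w, hY (by rwa [hcol] at hy), rfl⟩⟩
      · rw [hcol] at hq'
        have h1 := P.depth_of_ne_root q' hr
        have h2 := hadj q' hr
        rw [hq'] at h1 h2
        refine ⟨f q', h2, hcol q', ih q' (by omega) t (by omega), fun ha => ?_⟩
        obtain ⟨u, w, h, -, h3⟩ := harc ha
        rw [h3 q' t (by omega), h3 q (t + 1) (by omega)]
  exact main _ _ (Nat.le_add_left _ _) t ht

lemma not_allAccept_iff (T : ℕ) : ¬ N.AllAccept (P.search n R I) T ω ↔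
    ∃ v, (N.searchAt P ω I T v).flag = true ∧ (ω v).1 = P.root := by
  have h (v : V) : (P.search n R I).accept (N.run (P.search n R I) ω T v) = true ↔
      ((N.searchAt P ω I T v).flag = true → (ω v).1 ≠ P.root) := by
    rw [← N.searchAt_color P ω (I := I) T v]
    classical
    exact decide_eq_true_iff
  unfold AllAccept
  simp only [h]
  push Not
  rfl

end Network

/-! ### Counting favourable coins -/

/-- The number of ways to choose a colour and `n` ranks for every node, subject to independent
constraints. -/
lemma natCard_coins {V Q : Type*} [Fintype V] {n R : ℕ} (C : V → Set Q)
    (D : V → Fin n → Set (Fin R)) :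
    Nat.card {ω : V → Q × (Fin n → Fin R) // ∀ v, (ω v).1 ∈ C v ∧ ∀ p, (ω v).2 p ∈ D v p}
      = ∏ v, (Nat.card (C v) * ∏ p, Nat.card (D v p)) := by
  rw [Nat.card_congr (Equiv.subtypePiEquivPi (p := fun v (c : Q × (Fin n → Fin R)) =>
    c.1 ∈ C v ∧ ∀ p, c.2 p ∈ D v p)), Nat.card_pi]
  refine Finset.prod_congr rfl fun v _ => ?_
  rw [Nat.card_congr (Equiv.subtypeProdEquivProd (p := fun c => c ∈ C v)
      (q := fun r : Fin n → Fin R => ∀ p, r p ∈ D v p)), Nat.card_prod,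
    Nat.card_congr (Equiv.subtypePiEquivPi (p := fun p r => r ∈ D v p)), Nat.card_pi]

lemma natCard_coins_univ {V Q : Type*} [Fintype V] {n R : ℕ} :
    Nat.card (V → Q × (Fin n → Fin R)) = ∏ _v : V, (Nat.card Q * ∏ _p : Fin n, R) := by
  rw [Nat.card_pi]
  simp [Nat.card_prod]

/-- The colours that node `v` may have if the nodes `g q` have to be coloured `q`. -/
def colorSet {V Q : Type*} (g : Q → V) (v : V) : Set Q := {c | ∀ q, g q = v → c = q}

/-- Only the nodes in the image of `g` are constrained, each to a single colour as `g` is injective.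
-/
lemma prod_colorSet {V Q : Type*} [Fintype V] [Fintype Q] [Nonempty Q] {g : Q → V}
    (hg : Function.Injective g) :
    ((1 : ℝ) / Fintype.card Q) ^ Fintype.card Q
      ≤ ∏ v, ((Nat.card (colorSet g v) : ℝ) / Nat.card Q) := by
  classical
  have hQ : (0 : ℝ) < Fintype.card Q := by exact_mod_cast Fintype.card_pos
  have h1 : ((1 : ℝ) / Fintype.card Q) ^ Fintype.card Q
      = ∏ v : V, if v ∈ Finset.univ.image g then (1 : ℝ) / Fintype.card Q else 1 := by
    rw [Finset.prod_ite_mem, Finset.univ_inter, Finset.prod_const, Finset.card_image_of_injective _ hg,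
      Finset.card_univ]
  rw [h1]
  refine Finset.prod_le_prod (fun v _ => by split_ifs <;> positivity) fun v _ => ?_
  rw [Nat.card_eq_fintype_card (α := Q)]
  split_ifs with hv
  · obtain ⟨q, -, rfl⟩ := Finset.mem_image.1 hv
    have : Nonempty (colorSet g (g q)) := ⟨⟨q, fun q' h => (hg h).symm⟩⟩
    have : 1 ≤ Nat.card (colorSet g (g q)) := Nat.card_pos
    gcongr
    exact_mod_cast this
  · have : colorSet g v = Set.univ := Set.eq_univ_of_forall fun c q h =>
      absurd (Finset.mem_image.2 ⟨q, Finset.mem_univ _, h⟩) hv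
    rw [this, Nat.card_congr (Equiv.Set.univ _), Nat.card_eq_fintype_card, div_self hQ.ne']

/-- The ranks less than `t` for the port `a`, and at least `t` for the other ports. -/
def rankSet {V : Type*} (R t : ℕ) (deg : V → ℕ) (a : V × ℕ) (v : V) (p : ℕ) : Set (Fin R) :=
  {r | ((v, p) = a → (r : ℕ) < t) ∧ ((v, p) ≠ a → p < deg v → t ≤ r)}

/-- The port `a` is charged the second factor too when it is a real port. This loss is harmless and
makes the exponent in `prod_rankSet` exactly the degree sum; ports beyond the degree cost nothing.
-/
lemma le_card_rankSet {V : Type*} [DecidableEq V] {R t : ℕ} (hR : 0 < R) (ht : t ≤ R) (deg : V → ℕ)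
    (a : V × ℕ) (v : V) (p : ℕ) :
    (if (v, p) = a then (t / R : ℝ) else 1) * (if p < deg v then (1 - t / R : ℝ) else 1)
      ≤ (Nat.card (rankSet R t deg a v p) : ℝ) / R := by
  have hR' : (0 : ℝ) < R := by exact_mod_cast hR
  have ht' : (t : ℝ) ≤ R := by exact_mod_cast ht
  have ha : (0 : ℝ) ≤ t / R := by positivity
  have ha1 : (t / R : ℝ) ≤ 1 := div_le_one_of_le₀ ht' hR'.le
  have c1 : Nat.card {r : Fin R // (r : ℕ) < t} = t := by
    rw [Nat.card_eq_fintype_card, Fintype.card_subtype, Fin.card_filter_val_lt, min_eq_right ht]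
  have c2 : Nat.card {r : Fin R // t ≤ (r : ℕ)} = R - t := by
    rw [Nat.card_eq_fintype_card, Fintype.card_subtype]
    have := Finset.card_filter_add_card_filter_not (s := Finset.univ) (fun r : Fin R => (r : ℕ) < t)
    rw [Fin.card_filter_val_lt, min_eq_right ht, Finset.card_univ, Fintype.card_fin] at this
    simp only [not_lt] at this
    omega
  by_cases hp : (v, p) = a
  · have : rankSet R t deg a v p = {r : Fin R | (r : ℕ) < t} := by
      ext r; simp [rankSet, hp]
    rw [this, if_pos hp]
    have c1' : Nat.card {r : Fin R | (r : ℕ) < t} = t := c1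
    rw [c1']
    refine mul_le_of_le_one_right ha ?_
    split_ifs <;> linarith
  · rw [if_neg hp, one_mul]
    split_ifs with hd
    · have : rankSet R t deg a v p = {r : Fin R | t ≤ (r : ℕ)} := by
        ext r; simp [rankSet, hp, hd]
      have c2' : Nat.card {r : Fin R | t ≤ (r : ℕ)} = R - t := c2
      rw [this, c2', Nat.cast_sub ht, sub_div, div_self hR'.ne']
    · have : rankSet R t deg a v p = Set.univ := by
        ext r; simp [rankSet, hp, hd]
      rw [this, Nat.card_congr (Equiv.Set.univ _), Nat.card_fin, div_self hR'.ne']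

lemma prod_rankSet {V : Type*} [Fintype V] {n R t : ℕ} (hR : 0 < R) (ht : t ≤ R)
    (deg : V → ℕ) (u : V) (i : Fin n) :
    (t / R : ℝ) * (1 - t / R) ^ (∑ v, deg v)
      ≤ ∏ v, ∏ p : Fin n, ((Nat.card (rankSet R t deg (u, (i : ℕ)) v p) : ℝ) / R) := by
  classical
  have hR' : (0 : ℝ) < R := by exact_mod_cast hR
  have ht' : (t : ℝ) ≤ R := by exact_mod_cast ht
  have ha : (0 : ℝ) ≤ t / R := by positivity
  have ha1 : (t / R : ℝ) ≤ 1 := div_le_one_of_le₀ ht' hR'.le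
  have hb : (0 : ℝ) ≤ 1 - t / R := by linarith
  calc (t / R : ℝ) * (1 - t / R) ^ (∑ v, deg v)
      ≤ (∏ v : V, ∏ p : Fin n, if (v, (p : ℕ)) = (u, (i : ℕ)) then (t / R : ℝ) else 1) *
        ∏ v : V, ∏ p : Fin n, if (p : ℕ) < deg v then (1 - t / R : ℝ) else 1 := by
        refine mul_le_mul (le_of_eq ?_) ?_ (by positivity)
          (Finset.prod_nonneg fun v _ => Finset.prod_nonneg fun p _ => by split_ifs <;> linarith)
        · rw [← Fintype.prod_prod_type' (f := fun (v : V) (p : Fin n) =>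
            if (v, (p : ℕ)) = (u, (i : ℕ)) then (t / R : ℝ) else 1)]
          rw [Finset.prod_eq_single (u, i)]
          · simp
          · rintro ⟨v, p⟩ - hne
            refine if_neg fun h => hne ?_
            rw [Prod.mk.injEq] at h
            exact Prod.ext h.1 (Fin.ext h.2)
          · simp
        · rw [← Finset.prod_pow_eq_pow_sum]
          refine Finset.prod_le_prod (fun v _ => by positivity) fun v _ => ?_
          rw [Finset.prod_ite, Finset.prod_const, Finset.prod_const_one, mul_one]
          refine pow_le_pow_of_le_one hb (by linarith) ?_
          rw [Fin.card_filter_val_lt]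
          exact min_le_right _ _
    _ = ∏ v : V, ∏ p : Fin n, ((if (v, (p : ℕ)) = (u, (i : ℕ)) then (t / R : ℝ) else 1) *
          (if (p : ℕ) < deg v then (1 - t / R : ℝ) else 1)) := by
        simp only [Finset.prod_mul_distrib]
    _ ≤ _ := by
        refine Finset.prod_le_prod (fun v _ => Finset.prod_nonneg fun p _ => ?_) fun v _ =>
          Finset.prod_le_prod (fun p _ => ?_) fun p _ => le_card_rankSet hR ht deg _ v p
        all_goals exact mul_nonneg (by split_ifs <;> linarith) (by split_ifs <;> linarith)

/-- The coins that give the colours `q` to the nodes `g q`, and a rank less than `t` to the port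
`a` only. -/
def coinSet {V Q : Type*} (n R t : ℕ) (deg : V → ℕ) (g : Q → V) (a : V × ℕ) :
    Set (V → Q × (Fin n → Fin R)) :=
  {ω | ∀ v, (ω v).1 ∈ colorSet g v ∧ ∀ p : Fin n, (ω v).2 p ∈ rankSet R t deg a v p}

lemma le_natCard_coinSet {V Q : Type*} [Fintype V] [Fintype Q] [Nonempty Q] {n R t : ℕ}
    (hR : 0 < R) (ht : t ≤ R) (deg : V → ℕ) {g : Q → V} (hg : Function.Injective g) (u : V)
    (i : Fin n) :
    ((1 : ℝ) / Fintype.card Q) ^ Fintype.card Q * ((t / R : ℝ) * (1 - t / R) ^ (∑ v, deg v)) *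
      Nat.card (V → Q × (Fin n → Fin R)) ≤ Nat.card (coinSet n R t deg g (u, (i : ℕ))) := by
  have hT : (0 : ℝ) < Nat.card (V → Q × (Fin n → Fin R)) := by
    have : Nonempty (Fin R) := ⟨⟨0, hR⟩⟩
    exact_mod_cast Nat.card_pos
  have hR' : (0 : ℝ) < R := by exact_mod_cast hR
  have ht' : (t : ℝ) ≤ R := by exact_mod_cast ht
  have ha1 : (t / R : ℝ) ≤ 1 := div_le_one_of_le₀ ht' hR'.le
  rw [← le_div_iff₀ hT]
  have h1 : Nat.card (coinSet n R t deg g (u, (i : ℕ))) = ∏ v, (Nat.card (colorSet g v) *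
      ∏ p : Fin n, Nat.card (rankSet R t deg (u, (i : ℕ)) v p)) := natCard_coins _ _
  rw [h1, natCard_coins_univ]
  push_cast
  rw [← Finset.prod_div_distrib]
  simp only [mul_div_mul_comm, ← Finset.prod_div_distrib]
  rw [Finset.prod_mul_distrib]
  refine mul_le_mul (prod_colorSet hg) (prod_rankSet hR ht deg u i) ?_ ?_
  · exact mul_nonneg (by positivity) (pow_nonneg (by linarith) _)
  · exact Finset.prod_nonneg fun v _ => by positivity

lemma le_natCard_colors {V Q : Type*} [Fintype V] [Fintype Q] [Nonempty Q] {n R : ℕ}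
    (hR : 0 < R) {g : Q → V} (hg : Function.Injective g) :
    ((1 : ℝ) / Fintype.card Q) ^ Fintype.card Q * Nat.card (V → Q × (Fin n → Fin R))
      ≤ Nat.card {ω : V → Q × (Fin n → Fin R) | ∀ q, (ω (g q)).1 = q} := by
  have hT : (0 : ℝ) < Nat.card (V → Q × (Fin n → Fin R)) := by
    have : Nonempty (Fin R) := ⟨⟨0, hR⟩⟩
    exact_mod_cast Nat.card_pos
  have hR' : (R : ℝ) ≠ 0 := by exact_mod_cast hR.ne'
  rw [← le_div_iff₀ hT]
  have h0 : {ω : V → Q × (Fin n → Fin R) | ∀ q, (ω (g q)).1 = q} = {ω | ∀ v,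
      (ω v).1 ∈ colorSet g v ∧ ∀ p : Fin n, (ω v).2 p ∈ (Set.univ : Set (Fin R))} := by
    ext ω
    exact ⟨fun h v => ⟨fun q hq => hq ▸ h q, fun _ => trivial⟩, fun h q => (h (g q)).1 q rfl⟩
  have h1 : Nat.card {ω : V → Q × (Fin n → Fin R) | ∀ q, (ω (g q)).1 = q}
      = ∏ v, (Nat.card (colorSet g v) * ∏ p : Fin n, Nat.card (Set.univ : Set (Fin R))) := by
    rw [h0]; exact natCard_coins _ _
  rw [h1, natCard_coins_univ]
  push_cast
  rw [← Finset.prod_div_distrib]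
  refine (prod_colorSet hg).trans (le_of_eq (Finset.prod_congr rfl fun v _ => ?_))
  rw [Nat.card_congr (Equiv.Set.univ (Fin R)), Nat.card_fin]
  rw [mul_div_mul_right]
  simp [hR']

/-- With a suitable threshold, a given one of `N` ranks is the only small one with probability at
least `1 / (8 N)`. -/
lemma le_threshold {N R : ℕ} (hN : 0 < N) (hR : 2 * N ≤ R) :
    (1 : ℝ) / (8 * N) ≤ ((R / (2 * N) : ℕ) / R : ℝ) * (1 - (R / (2 * N) : ℕ) / R) ^ N := by
  have hN' : (0 : ℝ) < N := by exact_mod_cast hN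
  have hR' : (0 : ℝ) < R := by exact_mod_cast (by omega : 0 < R)
  -- Since `2 * N ≤ R`, rounding at most halves the quotient, so `t / R` lies between `1 / (4 * N)`
  -- and `1 / (2 * N)`. Bernoulli's inequality then bounds the power below by `1 / 2`.
  set t := R / (2 * N) with ht
  have h1 : t * (2 * N) ≤ R := Nat.div_mul_le_self _ _
  have h2 : R ≤ t * (4 * N) := by
    have h3 : R < t * (2 * N) + 2 * N := Nat.lt_div_mul_add (by omega)
    have h4 : 1 ≤ t := (Nat.one_le_div_iff (by omega)).2 hR
    nlinarith
  have h1' : (t : ℝ) * (2 * N) ≤ R := by exact_mod_cast h1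
  have h2' : (R : ℝ) ≤ t * (4 * N) := by exact_mod_cast h2
  have h3 : (t / R : ℝ) ≤ 1 / (2 * N) := by
    rw [div_le_div_iff₀ hR' (by positivity)]; linarith
  have h4 : 1 / (4 * N) ≤ (t / R : ℝ) := by
    rw [div_le_div_iff₀ (by positivity) hR']; linarith
  have h5 : (t / R : ℝ) * N ≤ 1 / 2 := by
    calc (t / R : ℝ) * N ≤ 1 / (2 * N) * N := by gcongr
      _ = 1 / 2 := by field_simp
  have h6 : (1 : ℝ) / (2 * N) ≤ 1 / 2 := by
    rw [div_le_div_iff₀ (by positivity) (by positivity)]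
    have : (1 : ℝ) ≤ N := by exact_mod_cast hN
    linarith
  have h7 : (1 / 2 : ℝ) ≤ (1 - t / R) ^ N := by
    have := one_add_mul_le_pow (a := -(t / R : ℝ)) (by linarith) N
    rw [← sub_eq_add_neg] at this
    linarith
  calc (1 : ℝ) / (8 * N) = 1 / (4 * N) * (1 / 2) := by field_simp; norm_num
    _ ≤ _ := mul_le_mul h4 h7 (by norm_num) (by positivity)

/-! ### Detection probability of one search -/

namespace Network

variable {V : Type*} [Fintype V] {M : Type}

lemma acceptProb_le_of_event (N : Network V) (A : LocalAlgorithm M) {T : ℕ} {δ : ℝ}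
    {E : Set (V → A.Coin)} (hE : ∀ ω ∈ E, ¬ N.AllAccept A T ω)
    (h : δ * Nat.card (V → A.Coin) ≤ Nat.card E) : N.acceptProb A T ≤ 1 - δ := by
  classical
  have hT : (0 : ℝ) < Nat.card (V → A.Coin) := by exact_mod_cast Nat.card_pos
  rw [acceptProb, div_le_iff₀ hT]
  have h1 : Nat.card {ω : V → A.Coin // N.AllAccept A T ω} + Nat.card E
      ≤ Nat.card (V → A.Coin) := by
    rw [← Nat.card_sum]
    refine Nat.card_le_card_of_injective
      (Sum.elim Subtype.val Subtype.val : _ → V → A.Coin) ?_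
    refine Function.Injective.sumElim Subtype.val_injective Subtype.val_injective ?_
    rintro ⟨a, ha⟩ ⟨b, hb⟩ rfl
    exact hE _ hb ha
  have h2 : (Nat.card {ω : V → A.Coin // N.AllAccept A T ω} : ℝ) + Nat.card E
      ≤ Nat.card (V → A.Coin) := by exact_mod_cast h1
  linarith

variable {Q : Type} [Fintype Q] (N : Network V) (P : TreePattern Q) {n R I : ℕ}
  [NeZero R] [NeZero I]

/-- If only a tree is searched for, a copy of it is found with constant probability. -/
lemma acceptProb_search_le_of_copy (hP : ¬ P.useArc)
    (hid : ∀ u v, Fin.ofNat I (N.id u) = Fin.ofNat I (N.id v) → u = v)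
    {f : Q → V} (hf : Function.Injective f)
    (hadj : ∀ q, q ≠ P.root → N.graph.Adj (f (P.par q)) (f q)) {T : ℕ}
    (hT : Finset.univ.sup P.depth < T) :
    N.acceptProb (P.search n R I) T ≤ 1 - ((1 : ℝ) / Fintype.card Q) ^ Fintype.card Q := by
  have : Nonempty Q := ⟨P.root⟩
  refine N.acceptProb_le_of_event (P.search n R I)
    (E := {ω : V → Q × (Fin n → Fin R) | ∀ q, (ω (f q)).1 = q}) (fun ω hω => ?_)
    (le_natCard_colors (Nat.pos_of_ne_zero (NeZero.ne R)) hf)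
  exact (N.not_allAccept_iff P ω T).2 ⟨f P.root, N.flag_of_copy P ω hid f hω hadj (T₀ := 0)
    (fun h => absurd h hP) (by omega), hω _⟩

/-- If many arcs of the network extend to a copy of a pattern, one of them is found with
correspondingly large probability. -/
lemma acceptProb_search_le_of_arcs
    (hid : ∀ u v, Fin.ofNat I (N.id u) = Fin.ofNat I (N.id v) → u = v)
    (hdeg : ∀ v, N.deg v ≤ n) (hR : 2 * ∑ v, N.deg v ≤ R) {D T : ℕ} (S : Finset (V × V))
    (hS : ∀ a ∈ S, N.graph.Adj a.1 a.2 ∧ ∃ f : Q → V, Function.Injective f ∧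
      (∀ q, q ≠ P.root → N.graph.Adj (f (P.par q)) (f q)) ∧
      ∀ q, (f q ≠ a.1 ∧ f q ≠ a.2 ∧ (P.adjTail q → N.graph.Adj (f q) a.1) ∧
        (P.adjHead q → N.graph.Adj (f q) a.2)) ∧
        ∃ p : N.graph.Walk a.2 (f q), p.length ≤ D)
    (hT : D + 1 + Finset.univ.sup P.depth < T) :
    N.acceptProb (P.search n R I) T
      ≤ 1 - S.card * (((1 : ℝ) / Fintype.card Q) ^ Fintype.card Q / (8 * ∑ v, N.deg v)) := by
  classical
  have hQ : Nonempty Q := ⟨P.root⟩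
  have hR0 : 0 < R := Nat.pos_of_ne_zero (NeZero.ne R)
  set m := ∑ v, N.deg v with hm
  have hpos : ∀ a ∈ S, 0 < m := by
    intro a ha
    have h1 : N.deg a.1 ≤ m := Finset.single_le_sum (fun _ _ => Nat.zero_le _) (Finset.mem_univ _)
    have h2 := (N.portTo (hS a ha).1).2
    omega
  choose hadj f hf hfadj hfgood using hS
  set t := R / (2 * m) with ht
  have htR : t ≤ R := Nat.div_le_self _ _
  -- For coins in the set of `a`, the arc `a` alone has rank below `t`. It is then the strict
  -- minimum, although other ranks may coincide.
  have hE : ∀ a : S, ∀ ω ∈ coinSet n R t N.deg (f a a.2)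
      (a.1.1, (N.portTo (hadj a a.2) : ℕ)), ∀ u' w' (h' : N.graph.Adj u' w'),
      ((u', w') ≠ a.1 → t ≤ portRank (ω u').2 (N.portTo h')) ∧
      ((u', w') = a.1 → portRank (ω u').2 (N.portTo h') < t) := by
    rintro ⟨⟨u, w⟩, ha⟩ ω hω u' w' h'
    have hlt : (N.portTo h' : ℕ) < n := (N.portTo h').2.trans_le (hdeg u')
    have hr := (hω u').2 ⟨_, hlt⟩
    rw [portRank, dif_pos hlt]
    refine ⟨fun hne => hr.2 (fun he => hne ?_) (N.portTo h').2, fun he => hr.1 ?_⟩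
    · simp only [Prod.mk.injEq] at he ⊢
      obtain ⟨rfl, he⟩ := he
      exact ⟨rfl, N.portTo_inj h' _ (Fin.ext he)⟩
    · simp only [Prod.mk.injEq] at he ⊢
      obtain ⟨rfl, rfl⟩ := he
      exact ⟨rfl, rfl⟩
  refine N.acceptProb_le_of_event (P.search n R I)
    (E := {ω : V → Q × (Fin n → Fin R) | ∃ a : S, ω ∈ coinSet n R t N.deg (f a a.2)
      (a.1.1, (N.portTo (hadj a a.2) : ℕ))}) ?_ ?_
  · rintro ω ⟨a, hω⟩
    have hcol : ∀ q, (ω (f a a.2 q)).1 = q := fun q => (hω _).1 q rfl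
    refine (N.not_allAccept_iff P ω T).2 ⟨f a a.2 P.root, ?_, hcol _⟩
    refine N.flag_of_copy P ω hid (f a a.2) hcol (hfadj a a.2) (T₀ := D + 1)
      (fun _ => ⟨a.1.1, a.1.2, hadj a a.2, fun q => (hfgood a a.2 q).1, fun q s hs => ?_⟩) hT
    obtain ⟨p, hp⟩ := (hfgood a a.2 q).2
    refine N.best_eq_of_walk P ω _ (fun u' w' h' hne => ?_) p (by omega)
    have h1 := (hE a ω hω u' w' h').1 hne
    have h2 := (hE a ω hω _ _ (hadj a a.2)).2 rfl
    exact Fin.lt_def.2 (h2.trans_le h1)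
  -- The coins determine the arc of small rank, so the events of different arcs are disjoint and
  -- their probabilities add up.
  · have hinj : Function.Injective (fun x : Σ a : S, coinSet n R t N.deg (f a a.2)
        (a.1.1, (N.portTo (hadj a a.2) : ℕ)) => (⟨x.2.1, x.1, x.2.2⟩ :
        {ω : V → Q × (Fin n → Fin R) | ∃ a : S, ω ∈ coinSet n R t N.deg (f a a.2)
          (a.1.1, (N.portTo (hadj a a.2) : ℕ))})) := by
      rintro ⟨a, ω, ha⟩ ⟨b, ω', hb⟩ h
      obtain rfl : ω = ω' := congrArg Subtype.val h
      obtain rfl : a = b := by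
        by_contra hne
        have h1 := (hE a ω ha _ _ (hadj a a.2)).2 rfl
        have h2 := (hE b ω hb _ _ (hadj a a.2)).1 fun h => hne (Subtype.ext h)
        omega
      rfl
    have hcard := Nat.card_le_card_of_injective _ hinj
    rw [Nat.card_sigma] at hcard
    refine le_trans ?_ (Nat.cast_le.2 hcard)
    push_cast
    have hb : ∀ a : S, ((1 : ℝ) / Fintype.card Q) ^ Fintype.card Q / (8 * m) *
        Nat.card (V → Q × (Fin n → Fin R)) ≤ Nat.card (coinSet n R t N.deg (f a a.2)
        (a.1.1, (N.portTo (hadj a a.2) : ℕ))) := by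
      intro a
      have h1 := le_natCard_coinSet (n := n) hR0 htR N.deg (hf a a.2) a.1.1
        ⟨_, (N.portTo (hadj a a.2)).2.trans_le (hdeg _)⟩
      refine le_trans ?_ h1
      rw [div_eq_mul_one_div]
      gcongr
      exact le_threshold (hpos a a.2) hR
    have hsum := Finset.sum_le_sum (s := Finset.univ) fun a _ => hb a
    rw [Finset.sum_const, Finset.card_univ, Fintype.card_coe, nsmul_eq_mul, ← mul_assoc] at hsum
    exact hsum

end Network

/-! ### Rooted trees, amplification, and arcs in copies of `H` -/

/-- Parents and depths in a tree with a chosen root. -/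
lemma exists_parent_of_isTree {Z : Type*} {T : SimpleGraph Z} (hT : T.IsTree) (r : Z) :
    ∃ (par : Z → Z) (depth : Z → ℕ), depth r = 0 ∧
      (∀ z, z ≠ r → depth z = depth (par z) + 1 ∧ T.Adj (par z) z) ∧
      ∀ a b, T.Adj a b → (a ≠ r ∧ par a = b) ∨ (b ≠ r ∧ par b = a) := by
  choose p hp hlen using fun z => hT.connected.exists_path_of_dist r z
  -- The path to `a` followed by the edge to `b` is a shortest path, hence the chosen path to `b`,
  -- since paths in a tree are unique.
  have hedge : ∀ a b, T.Adj a b → T.dist r b = T.dist r a + 1 →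
      b ≠ r ∧ (p b).penultimate = a := by
    intro a b hab hd
    refine ⟨fun h => by rw [h, SimpleGraph.dist_self] at hd; omega, ?_⟩
    have h1 : ((p a).concat hab).IsPath := by
      refine SimpleGraph.Walk.isPath_of_length_eq_dist _ ?_
      rw [SimpleGraph.Walk.length_concat, hlen, hd]
    rw [(hT.existsUnique_path r b).unique (hp b) h1, SimpleGraph.Walk.penultimate_concat]
  refine ⟨fun z => (p z).penultimate, fun z => T.dist r z, SimpleGraph.dist_self, fun z hz => ?_,
    fun a b hab => ?_⟩
  · have hnil : ¬ (p z).Nil := fun h => hz h.eq.symm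
    have hadj := (p z).adj_penultimate hnil
    refine ⟨?_, hadj⟩
    rcases hT.dist_eq_dist_add_one_of_adj r hadj with h | h
    · have h1 := SimpleGraph.dist_le (p z).dropLast
      have h2 := (p z).length_dropLast_add_one hnil
      rw [hlen] at h2
      omega
    · exact h
  · rcases hT.dist_eq_dist_add_one_of_adj r hab with h | h
    · exact Or.inl (hedge b a hab.symm h)
    · exact Or.inr (hedge a b hab h)

/-- Both estimates are instances of `t + 1 ≤ exp t`: `t = -η` bounds a single trial, and `t = 2`
gives `3 ≤ exp 2`. -/
lemma pow_le_one_third {a η : ℝ} (ha : 0 ≤ a) (hη : a ≤ 1 - η) {k : ℕ} (hk : 2 ≤ η * k) :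
    a ^ k ≤ 1 / 3 := by
  calc a ^ k ≤ Real.exp (-η) ^ k := by
        gcongr
        have := Real.add_one_le_exp (-η)
        linarith
    _ = Real.exp (-(η * k)) := by rw [← Real.exp_nat_mul]; ring_nf
    _ ≤ Real.exp (-2) := Real.exp_le_exp.2 (by linarith)
    _ ≤ 1 / 3 := by
        rw [Real.exp_neg, one_div]
        refine inv_anti₀ (by norm_num) ?_
        have := Real.add_one_le_exp (2 : ℝ)
        linarith

namespace Network

variable {V : Type*} (N : Network V)

lemma deg_eq_degree (v : V) [Fintype (N.graph.neighborSet v)] : N.deg v = N.graph.degree v := by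
  rw [← SimpleGraph.card_neighborSet_eq_degree, ← Fintype.card_congr (N.port v), Fintype.card_fin]

lemma deg_le [Fintype V] (v : V) : N.deg v ≤ Fintype.card V := by
  classical
  rw [deg_eq_degree]
  exact (N.graph.degree_lt_card_verts v).le

lemma sum_deg [Fintype V] : ∑ v, N.deg v = 2 * N.graph.edgeSet.ncard := by
  classical
  simp only [deg_eq_degree]
  rw [SimpleGraph.sum_degrees_eq_twice_card_edges, ← SimpleGraph.coe_edgeFinset,
    Set.ncard_coe_finset]

lemma acceptProb_sequential_le [Finite V] {M : Type} [Inhabited M] {k R : ℕ} (P : Fin k → LocalAlgorithm M)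
    (hR : 0 < R) (j : Fin k) : N.acceptProb (sequential P R) (k * R) ≤ N.acceptProb (P j) R := by
  classical
  rw [acceptProb_sequential N P hR, ← Finset.mul_prod_erase _ _ (Finset.mem_univ j)]
  exact mul_le_of_le_one_right (acceptProb_nonneg _ _ _)
    (Finset.prod_le_one (fun _ _ => acceptProb_nonneg _ _ _) fun _ _ => acceptProb_le_one _ _ _)

end Network

/-- The arcs of `G` that play the role of the arc from `x` to `y` in a copy of `H`. -/
def copyArcs {W V : Type*} (H : SimpleGraph W) (G : SimpleGraph V) (x y : W) : Set (V × V) :=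
  {a | ∃ F : SimpleGraph.Copy H G, a = (F x, F y)}

/-- In a graph that is far from being `H`-free, many arcs belong to copies of `H`, in a given
role. -/
lemma IsFarFromFree.le_ncard_copyArcs {W V : Type*} [Finite V] {H : SimpleGraph W} {ε : ℝ}
    {G : SimpleGraph V} (h : IsFarFromFree H ε G) {x y : W} (hxy : H.Adj x y) :
    ε * G.edgeSet.ncard ≤ (copyArcs H G x y).ncard := by
  set S : Set (Sym2 V) := (fun a : V × V => s(a.1, a.2)) '' copyArcs H G x y with hS
  have hsub : S ⊆ G.edgeSet := by
    rintro _ ⟨_, ⟨F, rfl⟩, rfl⟩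
    exact F.toHom.map_adj hxy
  have hcard : S.ncard ≤ (copyArcs H G x y).ncard := Set.ncard_image_le
  by_contra! hlt
  -- A copy surviving the removal of `S` would map `{x, y}` to an edge of `S`.
  refine h.2 S hsub ((Nat.cast_le.2 hcard).trans_lt hlt) ?_
  rintro ⟨F⟩
  have h1 := F.toHom.map_adj hxy
  rw [SimpleGraph.deleteEdges_adj] at h1
  exact h1.2 ⟨_, ⟨(SimpleGraph.Copy.ofLE _ _ (G.deleteEdges_le S)).comp F, rfl⟩, rfl⟩

lemma IsFarFromFree.isContained {W V : Type*} {H : SimpleGraph W} {ε : ℝ}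
    {G : SimpleGraph V} (hε : 0 < ε) (h : IsFarFromFree H ε G) : H.IsContained G := by
  have h1 := h.2 ∅ (Set.empty_subset _) (by
    have : (0 : ℝ) < G.edgeSet.ncard := by exact_mod_cast h.1
    simpa using mul_pos hε this)
  rwa [SimpleGraph.deleteEdges_empty, SimpleGraph.not_free] at h1

universe v

/-- `H`-freeness can be tested in `O(1 / ε)` rounds by an algorithm that uses the messages of the
search for a tree pattern with nodes `Q`. -/
def IsSearchTestable {W : Type} (H : SimpleGraph W) (Q : Type) : Prop :=
  -- `T` is chosen before `n`, `R` and `I`, so the number of rounds cannot depend on the network.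
  ∃ C : ℝ, ∀ ε : ℝ, 0 < ε → ε < 1 → ∃ T : ℕ, T ≤ C / ε ∧
    ∀ (n R I : ℕ) [NeZero R] [NeZero I], ∃ A : LocalAlgorithm (SearchMessage R I Q),
      ∀ (V : Type v) [Fintype V] (N : Network V), (∀ u, N.deg u ≤ n) → 2 * ∑ u, N.deg u ≤ R →
        (∀ u w, Fin.ofNat I (N.id u) = Fin.ofNat I (N.id w) → u = w) →
        (H.Free N.graph → ∀ ω, N.AllAccept A T ω) ∧
        (IsFarFromFree H ε N.graph → N.acceptProb A T ≤ 1 / 3)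

/-! ### Trees attached to the edge -/

section Patterns

variable {W : Type} {H : SimpleGraph W} {x y : W}

/-- The attachment makes `H` connected. Distances from `y` in `H` are then lengths of walks, and
they bound how far the arc has to travel inside a copy. -/
lemma reachable_of_isTree_compl (hxy : H.Adj x y)
    (hT : (H.induce ({x, y}ᶜ : Set W)).IsTree)
    (hZ : ∃ z, z ∈ ({x, y}ᶜ : Set W) ∧ (H.Adj z x ∨ H.Adj z y)) (z : W)
    (hz : z ∈ ({x, y}ᶜ : Set W)) : H.Reachable y z := by
  obtain ⟨z₀, hz₀, h⟩ := hZ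
  have h1 : H.Reachable z₀ z :=
    (hT.connected ⟨z₀, hz₀⟩ ⟨z, hz⟩).map (SimpleGraph.Embedding.induce _).toHom
  refine SimpleGraph.Reachable.trans ?_ h1
  rcases h with h | h
  · exact hxy.symm.reachable.trans h.symm.reachable
  · exact h.symm.reachable

open Classical in
/-- An edge plus a tree can be tested for if there are connections between them. -/
lemma isSearchTestable_of_connection [Fintype W] (hxy : H.Adj x y)
    (hT : (H.induce ({x, y}ᶜ : Set W)).IsTree)
    (hZ : ∃ z, z ∈ ({x, y}ᶜ : Set W) ∧ (H.Adj z x ∨ H.Adj z y)) :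
    IsSearchTestable.{v} H ({x, y}ᶜ : Set W) := by
  obtain ⟨r⟩ := hT.connected.nonempty
  obtain ⟨par, depth, h0, hd, he⟩ := exists_parent_of_isTree hT r
  let P : TreePattern ({x, y}ᶜ : Set W) :=
    { root := r, par := par, depth := depth, depth_root := h0
      depth_of_ne_root := fun q hq => (hd q hq).1
      useArc := True
      adjTail := fun q => H.Adj q x
      adjHead := fun q => H.Adj q y }
  -- `D + 1` rounds bring the arc to the whole copy, and the depth of the tree plus one more bring
  -- the flags to the root. The `16` in `η` is the `8` of the threshold estimate times the two arcs
  -- of each edge.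
  set D := Finset.univ.sup fun z => H.dist y z
  set L := D + 1 + Finset.univ.sup depth + 1 with hL
  set η : ℝ := ((1 : ℝ) / Fintype.card ({x, y}ᶜ : Set W)) ^ Fintype.card ({x, y}ᶜ : Set W) / 16
    with hη
  have hQ : 0 < Fintype.card ({x, y}ᶜ : Set W) := Fintype.card_pos_iff.2 ⟨r⟩
  have hη0 : 0 < η := by positivity
  -- Each trial rejects with probability at least `η * ε`, so `2 / (η * ε)` trials suffice; as `ε <
  -- 1`, rounding up adds at most `1 / ε`.
  refine ⟨(2 / η + 1) * L, fun ε hε hε1 => ⟨⌈2 / (η * ε)⌉₊ * L, ?_, fun n R I _ _ => ?_⟩⟩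
  · push_cast
    rw [le_div_iff₀ hε]
    have h1 := (Nat.ceil_lt_add_one (a := 2 / (η * ε)) (by positivity)).le
    calc (⌈2 / (η * ε)⌉₊ : ℝ) * L * ε ≤ (2 / (η * ε) + 1) * L * ε := by gcongr
      _ = (2 / η + ε) * L := by field_simp
      _ ≤ (2 / η + 1) * L := by gcongr
  have : Inhabited (SearchMessage R I ({x, y}ᶜ : Set W)) := ⟨⟨0, 0, r, ⊤, false⟩⟩
  refine ⟨sequential (fun _ : Fin ⌈2 / (η * ε)⌉₊ => P.search n R I) L,
    fun V _ N hdeg hR hid => ⟨fun hfree ω => ?_, fun hfar => ?_⟩⟩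
  · refine (N.allAccept_sequential_iff _ (by omega) ω).2 fun j => ?_
    by_contra hrej
    obtain ⟨v, hflag, hv⟩ := (N.not_allAccept_iff P (fun u => ω u j) L).1 hrej
    obtain ⟨f, hf, hadj, harc⟩ := N.exists_copy_of_flag P _ hid hv hflag
    obtain ⟨u, w, huw, hgood⟩ := harc trivial
    have hyx := hxy.ne'
    let F : W → V := fun a => if h : a ∈ ({x, y}ᶜ : Set W) then f ⟨a, h⟩ else if a = x then u else w
    have hFx : F x = u := by simp [F]
    have hFy : F y = w := by simp [F, hyx]
    have hF : ∀ a (h : a ∈ ({x, y}ᶜ : Set W)), F a = f ⟨a, h⟩ := fun a h => dif_pos h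
    have hcases : ∀ a, a = x ∨ a = y ∨ a ∈ ({x, y}ᶜ : Set W) := fun a => by
      simp only [Set.mem_compl_iff, Set.mem_insert_iff, Set.mem_singleton_iff]; tauto
    -- An edge of `H` is `{x, y}`, a connection checked by its end in the tree, or an edge from a
    -- node to its parent.
    refine hfree ⟨⟨⟨F, fun {a b} hab => ?_⟩, fun a b hab => ?_⟩⟩
    · rcases hcases a with rfl | rfl | ha <;> rcases hcases b with rfl | rfl | hb
      · exact absurd hab (H.loopless.irrefl _)
      · rwa [hFx, hFy]
      · rw [hFx, hF b hb]; exact ((hgood ⟨b, hb⟩).2.2.1 hab.symm).symm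
      · rw [hFx, hFy]; exact huw.symm
      · exact absurd hab (H.loopless.irrefl _)
      · rw [hFy, hF b hb]; exact ((hgood ⟨b, hb⟩).2.2.2 hab.symm).symm
      · rw [hFx, hF a ha]; exact (hgood ⟨a, ha⟩).2.2.1 hab
      · rw [hFy, hF a ha]; exact (hgood ⟨a, ha⟩).2.2.2 hab
      · rw [hF a ha, hF b hb]
        rcases he ⟨a, ha⟩ ⟨b, hb⟩ hab with ⟨h1, h2⟩ | ⟨h1, h2⟩
        · have := hadj _ h1
          rw [show P.par ⟨a, ha⟩ = ⟨b, hb⟩ from h2] at this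
          exact this.symm
        · have := hadj _ h1
          rwa [show P.par ⟨b, hb⟩ = ⟨a, ha⟩ from h2] at this
    · change F a = F b at hab
      rcases hcases a with rfl | rfl | ha <;> rcases hcases b with rfl | rfl | hb
      · rfl
      · rw [hFx, hFy] at hab; exact absurd hab huw.ne
      · rw [hFx, hF b hb] at hab; exact absurd hab.symm (hgood _).1
      · rw [hFx, hFy] at hab; exact absurd hab.symm huw.ne
      · rfl
      · rw [hFy, hF b hb] at hab; exact absurd hab.symm (hgood _).2.1
      · rw [hFx, hF a ha] at hab; exact absurd hab (hgood _).1
      · rw [hFy, hF a ha] at hab; exact absurd hab (hgood _).2.1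
      · rw [hF a ha, hF b hb] at hab
        exact congrArg Subtype.val (hf hab)
  · rw [Network.acceptProb_sequential N _ (by omega), Finset.prod_const, Finset.card_univ,
      Fintype.card_fin]
    refine pow_le_one_third (η := η * ε) (Network.acceptProb_nonneg _ _ _) ?_ ?_
    · have hS := Network.acceptProb_search_le_of_arcs N P (n := n) hid hdeg hR (D := D) (T := L)
        (copyArcs H N.graph x y).toFinset ?_
        (by change D + 1 + Finset.univ.sup depth < L; omega)
      · refine hS.trans (sub_le_sub_left ?_ 1)
        rw [Network.sum_deg, ← Set.ncard_eq_toFinset_card']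
        have h1 := hfar.le_ncard_copyArcs hxy
        have hm : (0 : ℝ) < N.graph.edgeSet.ncard := by exact_mod_cast hfar.1
        calc η * ε = (ε * N.graph.edgeSet.ncard) * (η * 16 / (8 * (2 * N.graph.edgeSet.ncard))) := by
              field_simp; norm_num
          _ ≤ (copyArcs H N.graph x y).ncard * (η * 16 / (8 * (2 * N.graph.edgeSet.ncard))) := by
              gcongr
          _ = _ := by
              rw [hη]
              push_cast
              rw [div_mul_cancel₀ _ (by norm_num : (16 : ℝ) ≠ 0)]
      · intro a ha
        obtain ⟨F, rfl⟩ := Set.mem_toFinset.1 ha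
        refine ⟨F.toHom.map_adj hxy, fun q => F q, fun q q' h => Subtype.ext (F.injective h),
          fun q hq => F.toHom.map_adj (hd q hq).2, fun q => ⟨⟨fun h => ?_, fun h => ?_,
            fun h => F.toHom.map_adj h, fun h => F.toHom.map_adj h⟩, ?_⟩⟩
        · exact q.2 (Or.inl (F.injective h))
        · exact q.2 (Or.inr (F.injective h))
        · obtain ⟨p, hp⟩ := (reachable_of_isTree_compl hxy hT hZ q q.2).exists_walk_length_eq_dist
          refine ⟨p.map F.toHom, ?_⟩
          rw [SimpleGraph.Walk.length_map, hp]
          exact Finset.le_sup (f := fun z => H.dist y z) (Finset.mem_univ (q : W))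
    · have h1 := Nat.le_ceil (2 / (η * ε))
      rw [div_le_iff₀ (by positivity)] at h1
      linarith

/-! ### Trees not attached to the edge -/

/-- In a connected graph with an edge disjoint from a nonempty set `S`, some path of length two
starts in `S` and has its other two nodes outside `S`. -/
lemma exists_pendant_path {V : Type*} {G : SimpleGraph V} {S : Set V} {a s : V} (p : G.Walk a s)
    (hs : s ∈ S) {b : V} (ha : a ∉ S) (hb : b ∉ S) (hab : G.Adj a b) :
    ∃ s' ∈ S, ∃ u w, G.Adj s' u ∧ G.Adj u w ∧ u ∉ S ∧ w ∉ S := by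
  -- The walk advances with the node just left kept as `b`. When it first enters `S`, the last two
  -- nodes are still outside.
  induction p generalizing b with
  | nil => exact absurd hs ha
  | @cons a c s h p ih =>
    by_cases hc : c ∈ S
    · exact ⟨c, hc, a, b, h.symm, hab, ha, hb⟩
    · exact ih hs hc ha h.symm

end Patterns

open Classical in
/-- The tree with parents `par` and depths `depth`, rooted at `z`, extended by a path `z`, `x`,
`y`. -/
noncomputable def pendantPattern {W : Type} {x y : W} (hxy : x ≠ y) (z : ({x, y}ᶜ : Set W))
    (par : ({x, y}ᶜ : Set W) → ({x, y}ᶜ : Set W)) (depth : ({x, y}ᶜ : Set W) → ℕ)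
    (h0 : depth z = 0) (hd : ∀ q, q ≠ z → depth q = depth (par q) + 1) : TreePattern W where
  root := z
  par q := if h : q ∈ ({x, y}ᶜ : Set W) then par ⟨q, h⟩ else if q = x then z else x
  depth q := if h : q ∈ ({x, y}ᶜ : Set W) then depth ⟨q, h⟩ else if q = x then 1 else 2
  depth_root := by rw [dif_pos z.2, h0]
  depth_of_ne_root q hq := by
    by_cases h : q ∈ ({x, y}ᶜ : Set W)
    · have := hd ⟨q, h⟩ fun e => hq (congrArg Subtype.val e)
      simp only [h, dif_pos, this, Subtype.coe_prop]
    · by_cases hx : q = x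
      · subst hx
        simp only [h, dif_neg, not_false_iff, if_true, Subtype.coe_prop, dif_pos, h0]
      · have hx' : x ∉ ({x, y}ᶜ : Set W) := by simp
        simp [hx, h]
  useArc := False
  adjTail _ := False
  adjHead _ := False

section

variable {W : Type} [Fintype W] {H : SimpleGraph W} {x y : W}

open Classical in
/-- An edge plus a tree can be tested for if there are no connections between them. -/
lemma isSearchTestable_of_no_connection (hxy : H.Adj x y)
    (hT : (H.induce ({x, y}ᶜ : Set W)).IsTree)
    (hZ : ∀ z, z ∈ ({x, y}ᶜ : Set W) → ¬ H.Adj z x ∧ ¬ H.Adj z y) :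
    IsSearchTestable.{v} H W := by
  obtain ⟨z₀⟩ := hT.connected.nonempty
  choose par depth h0 hd he using exists_parent_of_isTree hT
  -- The node where the path leaves the tree is not known beforehand, so each one is tried as root.
  let P (z : ({x, y}ᶜ : Set W)) : TreePattern W :=
    pendantPattern hxy.ne z (par z) (depth z) (h0 z) fun q hq => (hd z q hq).1
  have hcases : ∀ a, a = x ∨ a = y ∨ a ∈ ({x, y}ᶜ : Set W) := fun a => by
    simp only [Set.mem_compl_iff, Set.mem_insert_iff, Set.mem_singleton_iff]; tauto
  have hxZ : x ∉ ({x, y}ᶜ : Set W) := by simp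
  have hyZ : y ∉ ({x, y}ᶜ : Set W) := by simp
  have hPx (z) : (P z).par x = z := by simp [P, pendantPattern]
  have hPy (z) : (P z).par y = x := by simp [P, pendantPattern, hxy.ne']
  have hP (z) (q) (hq : q ∈ ({x, y}ᶜ : Set W)) : (P z).par q = par z ⟨q, hq⟩ := dif_pos hq
  set L := (Finset.univ.sup fun z => Finset.univ.sup (P z).depth) + 1 with hL
  have hPL : ∀ z, Finset.univ.sup (P z).depth < L := fun z =>
    Nat.lt_succ_of_le (Finset.le_sup (f := fun z => Finset.univ.sup (P z).depth)
      (Finset.mem_univ z))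
  have hQ : 0 < Fintype.card W := Fintype.card_pos_iff.2 ⟨x⟩
  set η : ℝ := ((1 : ℝ) / Fintype.card W) ^ Fintype.card W with hη
  have hη0 : 0 < η := by positivity
  set k := ⌈2 / η⌉₊ with hk
  have hk1 : 2 ≤ η * k := by
    have := Nat.le_ceil (2 / η)
    rw [div_le_iff₀ hη0] at this
    linarith
  have hk0 : 0 < k := Nat.ceil_pos.2 (by positivity)
  set e := Fintype.equivFin ({x, y}ᶜ : Set W) with he'
  set T := Fintype.card ({x, y}ᶜ : Set W) * (k * L) with hTdef
  refine ⟨T, fun ε hε hε1 => ⟨T, ?_, fun n R I _ _ => ?_⟩⟩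
  · rw [le_div_iff₀ hε]
    exact mul_le_of_le_one_right (by positivity) hε1.le
  have : Inhabited (SearchMessage R I W) := ⟨⟨0, 0, x, ⊤, false⟩⟩
  refine ⟨sequential (fun i => sequential (fun _ : Fin k => (P (e.symm i)).search n R I) L) (k * L),
    fun V _ N hdeg hR hid => ⟨fun hfree ω => ?_, fun hfar => ?_⟩⟩
  · refine (N.allAccept_sequential_iff _ (by positivity) ω).2 fun i => ?_
    refine (N.allAccept_sequential_iff _ (by omega) fun u => ω u i).2 fun j => ?_
    by_contra hrej
    obtain ⟨v, hflag, hv⟩ := (N.not_allAccept_iff (P (e.symm i)) (fun u => ω u i j) L).1 hrej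
    obtain ⟨f, hf, hadj, -⟩ := N.exists_copy_of_flag (P (e.symm i)) _ hid hv hflag
    set z := e.symm i
    have hfxy : N.graph.Adj (f x) (f y) := by
      have := hadj y fun h => hyZ (by
        have := z.2
        rwa [← show y = (z : W) from h] at this)
      rwa [hPy] at this
    -- The pattern is `H` with the additional edge from `z` to `x`, so a copy of it contains `H`.
    refine hfree ⟨⟨⟨f, fun {a b} hab => ?_⟩, hf⟩⟩
    rcases hcases a with rfl | rfl | ha <;> rcases hcases b with rfl | rfl | hb
    · exact absurd hab (H.loopless.irrefl _)
    · exact hfxy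
    · exact absurd hab.symm (hZ b hb).1
    · exact hfxy.symm
    · exact absurd hab (H.loopless.irrefl _)
    · exact absurd hab.symm (hZ b hb).2
    · exact absurd hab (hZ a ha).1
    · exact absurd hab (hZ a ha).2
    · rcases he z ⟨a, ha⟩ ⟨b, hb⟩ hab with ⟨h1, h2⟩ | ⟨h1, h2⟩
      · have := hadj a fun h => h1 (Subtype.ext h)
        rw [hP z a ha, h2] at this
        exact this.symm
      · have := hadj b fun h => h1 (Subtype.ext h)
        rwa [hP z b hb, h2] at this
  · obtain ⟨F⟩ := hfar.isContained hε
    let S : Set V := F '' ({x, y}ᶜ : Set W)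
    obtain ⟨p⟩ := N.connected (F x) (F z₀)
    have hnot : ∀ a, a ∉ ({x, y}ᶜ : Set W) → F a ∉ S := by
      rintro a ha ⟨b, hb, h⟩
      exact ha (F.injective h ▸ hb)
    obtain ⟨_, ⟨z', hz, rfl⟩, u, w, hzu, huw, hu, hw⟩ := exists_pendant_path (S := S) p
      ⟨z₀, z₀.2, rfl⟩ (hnot x hxZ) (hnot y hyZ) (F.toHom.map_adj hxy)
    let z : ({x, y}ᶜ : Set W) := ⟨z', hz⟩
    -- The tree keeps its place; the pendant path takes over the roles of `x` and `y`.
    let f : W → V := fun a => if a ∈ ({x, y}ᶜ : Set W) then F a else if a = x then u else w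
    have hfx : f x = u := by simp [f]
    have hfy : f y = w := by simp [f, hxy.ne']
    have hfZ : ∀ a, a ∈ ({x, y}ᶜ : Set W) → f a = F a := fun a h => if_pos h
    have hfS : ∀ a, a ∈ ({x, y}ᶜ : Set W) → f a ∈ S := fun a h => by
      rw [hfZ a h]; exact ⟨a, h, rfl⟩
    have hinj : Function.Injective f := by
      intro a b hab
      rcases hcases a with rfl | rfl | ha <;> rcases hcases b with rfl | rfl | hb
      · rfl
      · rw [hfx, hfy] at hab; exact absurd hab huw.ne
      · rw [hfx] at hab; exact absurd (hab ▸ hfS b hb) hu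
      · rw [hfx, hfy] at hab; exact absurd hab.symm huw.ne
      · rfl
      · rw [hfy] at hab; exact absurd (hab ▸ hfS b hb) hw
      · rw [hfx] at hab; exact absurd (hab ▸ hfS a ha) hu
      · rw [hfy] at hab; exact absurd (hab ▸ hfS a ha) hw
      · rw [hfZ a ha, hfZ b hb] at hab; exact F.injective hab
    have hadj : ∀ q, q ≠ (P z).root → N.graph.Adj (f ((P z).par q)) (f q) := by
      intro q hq
      rcases hcases q with rfl | rfl | hqZ
      · rw [hPx, hfx, hfZ z z.2]; exact hzu
      · rw [hPy, hfx, hfy]; exact huw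
      · rw [hP z q hqZ, hfZ q hqZ, hfZ _ (par z ⟨q, hqZ⟩).2]
        exact F.toHom.map_adj (hd z ⟨q, hqZ⟩ fun h => hq (congrArg Subtype.val h)).2
    refine (Network.acceptProb_sequential_le N _ (by positivity) (e z)).trans ?_
    rw [Network.acceptProb_sequential N _ (by omega), Finset.prod_const, Finset.card_univ,
      Fintype.card_fin]
    refine pow_le_one_third (η := η) (Network.acceptProb_nonneg _ _ _) ?_ hk1
    rw [Equiv.symm_apply_apply]
    exact Network.acceptProb_search_le_of_copy N (P z) (fun h => h) hid hinj hadj (hPL z)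

lemma IsEdgePlusTree.exists_isSearchTestable (hH : IsEdgePlusTree H) :
    ∃ (Q : Type) (_ : Fintype Q) (_ : Nonempty Q), IsSearchTestable.{v} H Q := by
  classical
  obtain ⟨x, y, hxy, hT⟩ := hH
  by_cases hZ : ∃ z, z ∈ ({x, y}ᶜ : Set W) ∧ (H.Adj z x ∨ H.Adj z y)
  · exact ⟨_, inferInstance, hT.connected.nonempty, isSearchTestable_of_connection hxy hT hZ⟩
  · refine ⟨_, inferInstance, ⟨x⟩, isSearchTestable_of_no_connection hxy hT fun z hz => ?_⟩
    push Not at hZ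
    exact hZ z hz

end

/-! ### Change of vertex type, and encoding of messages -/

lemma IsEdgePlusTree.iso {W W' : Type*} {H : SimpleGraph W} {H' : SimpleGraph W'} (e : H ≃g H')
    (hH : IsEdgePlusTree H) : IsEdgePlusTree H' := by
  obtain ⟨x, y, hxy, hT⟩ := hH
  refine ⟨e x, e y, e.map_adj_iff.2 hxy, ?_⟩
  refine (SimpleGraph.Iso.isTree_iff (e.induce ?_)).1 hT
  refine ⟨fun a ha => ?_, e.injective.injOn, fun b hb => ⟨e.symm b, ?_, e.apply_symm_apply b⟩⟩
  · simpa using ha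
  · simpa [e.symm_apply_eq] using hb

/-- It disposes of networks with a single node, where `Nat.log 2 n = 0` leaves no bits to send: they
contain no copy of `H`. -/
lemma IsEdgePlusTree.two_lt_card {W : Type*} [Fintype W] {H : SimpleGraph W}
    (hH : IsEdgePlusTree H) : 2 < Fintype.card W := by
  obtain ⟨x, y, hxy, hT⟩ := hH
  obtain ⟨z, hz⟩ := hT.connected.nonempty
  simp only [Set.mem_compl_iff, Set.mem_insert_iff, Set.mem_singleton_iff, not_or] at hz
  exact Fintype.two_lt_card_iff.2 ⟨x, y, z, hxy.ne, Ne.symm hz.1, Ne.symm hz.2⟩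

lemma IsFarFromFree.iso {W W' V : Type*} {H : SimpleGraph W} {H' : SimpleGraph W'} (e : H ≃g H')
    {ε : ℝ} {G : SimpleGraph V} (h : IsFarFromFree H ε G) : IsFarFromFree H' ε G :=
  ⟨h.1, fun S hS hlt => (SimpleGraph.free_congr_left e).not.1 (h.2 S hS hlt)⟩

/-- The messages of the search for a tree pattern have `O(log n)` bits. -/
lemma exists_encoding (Q : Type) [Fintype Q] [Nonempty Q] (c : ℕ) : ∃ K : ℕ, ∀ n, 2 ≤ n →
    ∃ (enc : SearchMessage (2 * n ^ 2 + 1) (n ^ c + 1) Q → Fin (K * Nat.log 2 n) → Bool)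
      (dec : (Fin (K * Nat.log 2 n) → Bool) → SearchMessage (2 * n ^ 2 + 1) (n ^ c + 1) Q),
      ∀ m, dec (enc m) = m := by
  classical
  set q := Fintype.card Q
  -- There are at most `n ^ (3 * c + q + 13)` messages, and the factor `2` pays for rounding the
  -- logarithm: `n ≤ 2 ^ (2 * Nat.log 2 n)` for `2 ≤ n`.
  refine ⟨2 * (3 * c + q + 20), fun n hn => ?_⟩
  set M := SearchMessage (2 * n ^ 2 + 1) (n ^ c + 1) Q
  set K := 2 * (3 * c + q + 20)
  let g : M → Fin (n ^ c + 1) × Fin (2 * n ^ 2 + 1) × Q × ArcKey (2 * n ^ 2 + 1) (n ^ c + 1) × Bool :=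
    fun m => (m.id, m.rank, m.color, m.best, m.flag)
  have hg : Function.Injective g := by
    rintro ⟨⟩ ⟨⟩ h
    simp only [g, Prod.mk.injEq] at h
    obtain ⟨rfl, rfl, rfl, rfl, rfl⟩ := h
    rfl
  have hcard : Fintype.card (Fin (n ^ c + 1) × Fin (2 * n ^ 2 + 1) × Q ×
      ArcKey (2 * n ^ 2 + 1) (n ^ c + 1) × Bool) ≤ Fintype.card (Fin (K * Nat.log 2 n) → Bool) := by
    have e1 : Fintype.card (ArcKey (2 * n ^ 2 + 1) (n ^ c + 1))
        = (2 * n ^ 2 + 1) * ((n ^ c + 1) * (n ^ c + 1)) + 1 := by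
      have e2 : Fintype.card (ArcKey (2 * n ^ 2 + 1) (n ^ c + 1)) =
          Fintype.card (Option (Fin (2 * n ^ 2 + 1) × Fin (n ^ c + 1) × Fin (n ^ c + 1))) :=
        Fintype.card_congr (Equiv.optionCongr
          (ofLex.trans ((Equiv.refl _).prodCongr ofLex)))
      rw [e2, Fintype.card_option, Fintype.card_prod, Fintype.card_prod, Fintype.card_fin,
        Fintype.card_fin]
    simp only [Fintype.card_prod, Fintype.card_fin, e1, Fintype.card_bool, Fintype.card_fun]
    have hn0 : 0 < n := by omega
    have hI : n ^ c + 1 ≤ n ^ (c + 1) := by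
      rw [pow_succ]; nlinarith [Nat.one_le_pow c n hn0]
    have hR : 2 * n ^ 2 + 1 ≤ n ^ 4 := by
      have h4 : 4 ≤ n ^ 2 := by nlinarith
      nlinarith
    have hq : q ≤ n ^ q := (Nat.lt_pow_self (by omega)).le
    have hB : (2 * n ^ 2 + 1) * ((n ^ c + 1) * (n ^ c + 1)) + 1
        ≤ n ^ (4 + ((c + 1) + (c + 1)) + 1) := by
      have h1 : (2 * n ^ 2 + 1) * ((n ^ c + 1) * (n ^ c + 1))
          ≤ n ^ (4 + ((c + 1) + (c + 1))) := by
        rw [pow_add, pow_add n (c + 1)]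
        gcongr
      rw [pow_succ n (4 + ((c + 1) + (c + 1)))]
      have h2 := Nat.one_le_pow (4 + ((c + 1) + (c + 1))) n hn0
      have h3 := Nat.mul_le_mul_left (n ^ (4 + ((c + 1) + (c + 1)))) hn
      omega
    calc (n ^ c + 1) * ((2 * n ^ 2 + 1) * (q *
          (((2 * n ^ 2 + 1) * ((n ^ c + 1) * (n ^ c + 1)) + 1) * 2)))
        ≤ n ^ (c + 1) * (n ^ 4 * (n ^ q * (n ^ (4 + ((c + 1) + (c + 1)) + 1) * n))) := by
          gcongr
      _ = n ^ (3 * c + q + 13) := by ring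
      _ ≤ n ^ (3 * c + q + 20) := Nat.pow_le_pow_right hn0 (by omega)
      _ ≤ (2 ^ (2 * Nat.log 2 n)) ^ (3 * c + q + 20) := by
          refine Nat.pow_le_pow_left ?_ _
          have h1 := Nat.lt_pow_succ_log_self (b := 2) (by omega) n
          have h2 : 1 ≤ Nat.log 2 n := Nat.log_pos (by omega) hn
          exact h1.le.trans (Nat.pow_le_pow_right (by omega) (by omega))
      _ = 2 ^ (K * Nat.log 2 n) := by rw [← pow_mul]; congr 1; ring
  obtain ⟨φ⟩ := Function.Embedding.nonempty_of_card_le hcard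
  have hφ : Function.Injective fun m => φ (g m) := φ.injective.comp hg
  have : Nonempty M := ⟨⟨0, 0, Classical.arbitrary Q, ⊤, false⟩⟩
  exact ⟨_, Function.invFun fun m => φ (g m), Function.leftInverse_invFun hφ⟩

/-- The protocol that accepts without any communication. -/
def acceptingProtocol : Protocol where
  State := Unit
  Coin := Unit
  coinFintype := inferInstance
  coinNonempty := inferInstance
  bandwidth := 0
  rounds := 0
  init _ _ _ := ()
  send _ _ _ := fun _ => false
  recv _ _ _ := ()
  accept _ := true

end CongestTesting

theorem theoremB {W : Type*} [Fintype W] (H : SimpleGraph W)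
    (hH : CongestTesting.IsEdgePlusTree H) :
    -- the constant of the round complexity depends on `H` only
    ∃ C : ℝ,
    -- identities have `O(log n)` bits: they are at most `n ^ c`
    ∀ c : ℕ,
    -- the constant in the `O(log n)` bound on the number of bits per message
    ∃ K : ℕ,
    ∀ ε : ℝ, 0 < ε → ε < 1 →
    -- the nodes know the number `n` of nodes: `A n` is the protocol for networks with `n` nodes
    ∃ A : ℕ → CongestTesting.Protocol,
      (∀ n, (A n).bandwidth ≤ K * Nat.log 2 n) ∧
      (∀ n, ((A n).rounds : ℝ) ≤ C / ε) ∧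
      ∀ (V : Type*) [Fintype V] (N : CongestTesting.Network V),
        (∀ v, N.id v ≤ Fintype.card V ^ c) →
        (H.Free N.graph →
          CongestTesting.Network.prob (A (Fintype.card V))
            {ω | ∀ v, N.output (A (Fintype.card V)) ω v = true} = 1) ∧
        (CongestTesting.IsFarFromFree H ε N.graph →
          2 / 3 ≤ CongestTesting.Network.prob (A (Fintype.card V))
            {ω | ∃ v, N.output (A (Fintype.card V)) ω v = false}) := by
  open CongestTesting in
  classical
  -- States and coins of a protocol live in `Type`, and colours are vertices of the pattern, so `H`
  -- is moved to a vertex type `Fin`.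
  have iso := H.overFinIso rfl
  obtain ⟨Q, _, _, C, hC⟩ := (hH.iso iso).exists_isSearchTestable
  refine ⟨C, fun c => ?_⟩
  obtain ⟨K, hK⟩ := exists_encoding Q c
  refine ⟨K, fun ε hε hε1 => ?_⟩
  obtain ⟨T, hT, hA⟩ := hC ε hε hε1
  have hC0 : 0 ≤ C / ε := (Nat.cast_nonneg T).trans hT
  choose enc dec henc using hK
  -- The degree sum is at most `n ^ 2`, so `2 * n ^ 2 + 1` ranks suffice; identities up to `n ^ c`
  -- stay distinct modulo `n ^ c + 1`.
  choose A hA using fun n : ℕ => hA n (2 * n ^ 2 + 1) (n ^ c + 1)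
  refine ⟨fun n => if hn : 2 ≤ n then
    (A n).toProtocol (K * Nat.log 2 n) T (enc n hn) (dec n hn) else acceptingProtocol,
    fun n => ?_, fun n => ?_, fun V _ N hid => ?_⟩
  · dsimp only
    split_ifs
    · exact le_rfl
    · exact Nat.zero_le _
  · dsimp only
    split_ifs
    · exact hT
    · exact (Nat.cast_zero (R := ℝ)).trans_le hC0
  · by_cases hn : 2 ≤ Fintype.card V
    · beta_reduce
      rw [dif_pos hn]
      have hsum : 2 * ∑ u, N.deg u ≤ 2 * Fintype.card V ^ 2 + 1 := by
        have : ∑ u, N.deg u ≤ Fintype.card V * Fintype.card V := by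
          refine (Finset.sum_le_sum fun u _ => N.deg_le u).trans (le_of_eq ?_)
          rw [Finset.sum_const, Finset.card_univ, smul_eq_mul]
        nlinarith
      have hinj : ∀ u w, Fin.ofNat (Fintype.card V ^ c + 1) (N.id u) = Fin.ofNat _ (N.id w) →
          u = w := by
        intro u w h
        refine N.id_injective ?_
        have := congrArg Fin.val h
        rwa [Fin.val_ofNat, Fin.val_ofNat, Nat.mod_eq_of_lt (Nat.lt_succ_of_le (hid u)),
          Nat.mod_eq_of_lt (Nat.lt_succ_of_le (hid w))] at this
      obtain ⟨h1, h2⟩ := hA (Fintype.card V) V N N.deg_le hsum hinj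
      refine ⟨fun hfree => ?_, fun hfar => ?_⟩
      · exact Network.prob_eq_one _ fun ω => (N.forall_output_toProtocol_iff _ (henc _ hn) ω).2
          (h1 ((SimpleGraph.free_congr_left iso).1 hfree) ω)
      · exact Network.two_thirds_le_prob N _ (henc _ hn) (h2 (hfar.iso iso))
    · beta_reduce
      rw [dif_neg hn]
      refine ⟨fun _ => Network.prob_eq_one _ fun ω v => rfl, fun hfar => ?_⟩
      obtain ⟨F⟩ := hfar.isContained hε
      have h1 := Fintype.card_le_of_injective F F.injective
      have h2 := hH.two_lt_card
      omega
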